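/- Let $n \ge 1$, let $S_n$ be the symmetric group on $[n]=\{1,\dots,n\}$ (permutations composed from right to left), let $T$ be its set of transpositions and $c=(1,2,\dots,n)$ the long cycle. Let $\ell_T$ be the minimal number of transpositions in a factorization, and let $NC(n)=\{\pi\in S_n : \ell_T(\pi)+\ell_T(\pi^{-1}c)=\ell_T(c)\}$, ordered by $\pi\le\sigma \iff \ell_T(\pi)+\ell_T(\pi^{-1}\sigma)=\ell_T(\sigma)$, be the non-crossing partition lattice. Let $F_n$ be the set of maximal chains of $NC(n)$; such a chain is written as a factorization $v=(t_1,\dots,t_{n-1})$ with $t_i\in T$ and $t_1\cdots t_{n-1}=c$, the chain being $1<t_1<t_1t_2<\cdots<t_1\cdots t_{n-1}=c$. The Hurwitz graph $G_T(n)$ has vertex set $F_n$, two chains being adjacent if they differ in exactly one element. Let $e=((1,2),(2,3),\dots,(n-1,n))\in F_n$, and write $u\le v$ if $u$ lies on a geodesic of $G_T(n)$ from $e$ to $v$; this defines the poset $\mathrm{Weak}(F_n)$. For $v=(t_1,\dots,t_{n-1})\in F_n$ let $G(v)$ be the geometric graph with vertices $1,\dots,n$ placed in cyclic order on a circle and with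 a straight edge $\{a,b\}$ for each factor $t_j=(a,b)$. A tree on $[n]$ is called non-crossing if, when it is drawn in this way, two distinct edges may intersect only in a common vertex; it is called alternating if the neighbors of each vertex $i$ are all larger than $i$ or all smaller than $i$. Theorem. The map $v\mapsto G(v)$ is a bijection from the set of all maximal elements of $\mathrm{Weak}(F_n)$ onto the set of all alternating non-crossing trees on the vertex set $[n]$. Moreover, if $n\ge 2$, then every maximal element of $\mathrm{Weak}(F_n)$ contains the transposition $(1,n)$ as a factor. -/

import Mathlib

namespace HurwitzWeak

/-- The long cycle `c = (1, 2, …, n)`; the vertices `1, …, n` are modelled by `0, …, n - 1` in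
`Fin n`, and permutations are composed from right to left. -/
abbrev longCycle (n : ℕ) : Equiv.Perm (Fin n) := finRotate n

/-- The reflection length: the least number of factors in an expression of `π` as a product of
transpositions. -/
noncomputable def reflLength {n : ℕ} (π : Equiv.Perm (Fin n)) : ℕ :=
  sInf {k : ℕ | ∃ l : List (Equiv.Perm (Fin n)),
    l.length = k ∧ (∀ t ∈ l, t.IsSwap) ∧ l.prod = π}

/-- The absolute order. -/
def AbsLE {n : ℕ} (π σ : Equiv.Perm (Fin n)) : Prop :=
  reflLength π + reflLength (π⁻¹ * σ) = reflLength σ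

/-- The non-crossing partition lattice `NC(n)`, as a set ordered by `AbsLE`. -/
def NC (n : ℕ) : Set (Equiv.Perm (Fin n)) :=
  {π | reflLength π + reflLength (π⁻¹ * longCycle n) = reflLength (longCycle n)}

/-- Maximal chains of `NC(n)`. -/
def IsMaximalChainNC {n : ℕ} (C : Set (Equiv.Perm (Fin n))) : Prop :=
  Maximal (fun D : Set (Equiv.Perm (Fin n)) => D ⊆ NC n ∧ IsChain AbsLE D) C

/-- An element of `F_n`, written as a factorization `t₁ ⋯ t_{n-1} = c` into transpositions.
By `bijOn_chain` below, these are the same as the maximal chains of `NC(n)`. -/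
@[ext]
structure F (n : ℕ) where
  word : List (Equiv.Perm (Fin n))
  length_word : word.length = n - 1
  isSwap : ∀ t ∈ word, t.IsSwap
  prod_word : word.prod = longCycle n

/-- The `k`-th element `t₁ ⋯ t_k` of the maximal chain that corresponds to a factorization
(equal to `c` for every `k ≥ n - 1`). -/
def F.chainElt {n : ℕ} (v : F n) (k : ℕ) : Equiv.Perm (Fin n) := (v.word.take k).prod

/-- The maximal chain `1 < t₁ < t₁t₂ < ⋯ < c` of `NC(n)` that corresponds to a factorization. -/
def F.chain {n : ℕ} (v : F n) : Set (Equiv.Perm (Fin n)) := Set.range v.chainElt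

/-- The Hurwitz graph `G_T(n)`: two maximal chains are adjacent if they differ in exactly one
element. See `hurwitzGraph_adj_iff_ncard` below for chains as sets. -/
def hurwitzGraph (n : ℕ) : SimpleGraph (F n) where
  Adj u v := ∃! k : ℕ, u.chainElt k ≠ v.chainElt k
  symm := ⟨fun u v h => by simpa only [ne_comm] using h⟩
  loopless := ⟨fun u h => by obtain ⟨k, hk, -⟩ := h; exact hk rfl⟩

theorem ofFn_swap_prod {α : Type*} [DecidableEq α] : ∀ (m : ℕ) (f : Fin (m + 1) → α),
    (List.ofFn (fun i : Fin m => Equiv.swap (f i.castSucc) (f i.succ))).prod =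
      (List.ofFn f).formPerm
  | 0, f => by simp
  | m + 1, f => by
    have ih := ofFn_swap_prod m (fun i => f i.succ)
    rw [List.ofFn_succ, List.prod_cons, List.ofFn_succ (f := f), List.ofFn_succ,
      List.formPerm_cons_cons, ← List.ofFn_succ (f := fun i => f i.succ), ← ih]
    rfl

theorem formPerm_ofFn_id (m : ℕ) :
    (List.ofFn (fun i : Fin (m + 1) => i)).formPerm = finRotate (m + 1) := by
  ext i
  have h := List.formPerm_apply_getElem (List.ofFn (fun i : Fin (m + 1) => i))
    (List.nodup_ofFn.2 fun _ _ h => h) i.1 (by simpa using Nat.lt_succ_iff.1 i.2)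
  simp only [List.getElem_ofFn, List.length_ofFn, Fin.eta] at h
  rw [h, finRotate_apply, Fin.val_add, Fin.val_one', Nat.add_mod_mod]

theorem prod_swaps_aux (m : ℕ) :
    (List.ofFn (fun i : Fin m => Equiv.swap i.castSucc i.succ)).prod = finRotate (m + 1) := by
  rw [← formPerm_ofFn_id, ← ofFn_swap_prod]

/-- The word `((1,2), (2,3), …, (n-1,n))`. -/
def idWord (n : ℕ) : List (Equiv.Perm (Fin n)) :=
  List.ofFn (fun i : Fin (n - 1) =>
    Equiv.swap (⟨i.1, by omega⟩ : Fin n) ⟨i.1 + 1, by omega⟩)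

/-- The base point `e = ((1,2), (2,3), …, (n-1,n))` of `F_n`. -/
def e (n : ℕ) : F n where
  word := idWord n
  length_word := by simp [idWord]
  isSwap := by
    intro t ht
    simp only [idWord, List.mem_ofFn] at ht
    obtain ⟨i, rfl⟩ := ht
    exact ⟨_, _, by simp [Fin.ext_iff], rfl⟩
  prod_word := by
    cases n with
    | zero => ext x; exact x.elim0
    | succ m => exact prod_swaps_aux m

/-- The weak order on `F_n`: `u ≤ v` if `u` lies on a geodesic of the Hurwitz graph
from `e` to `v`. -/
def WeakLE {n : ℕ} (u v : F n) : Prop :=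
  ∃ p : (hurwitzGraph n).Walk (e n) v, p.length = (hurwitzGraph n).dist (e n) v ∧ u ∈ p.support

/-- The maximal elements of `Weak(F_n)`. -/
def IsWeakMax {n : ℕ} (v : F n) : Prop := ∀ u : F n, WeakLE v u → u = v

/-- The graph `G(v)`, with an edge `{a, b}` for every factor `(a, b)` of `v`. -/
def graph {n : ℕ} (v : F n) : SimpleGraph (Fin n) where
  Adj a b := a ≠ b ∧ Equiv.swap a b ∈ v.word
  symm := ⟨fun a b h => ⟨h.1.symm, by rw [Equiv.swap_comm]; exact h.2⟩⟩
  loopless := ⟨fun a h => h.1 rfl⟩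

/-- The vertices drawn on the unit circle, in cyclic order. -/
noncomputable def circlePt {n : ℕ} (i : Fin n) : ℂ :=
  Complex.exp (((2 * Real.pi * (i : ℕ) / n : ℝ) : ℂ) * Complex.I)

/-- A graph on vertices drawn on a circle, with straight edges, is non-crossing if two edges may
intersect only in a common vertex. See `isNonCrossing_iff` below for the combinatorial form. -/
def IsNonCrossing {n : ℕ} (T : SimpleGraph (Fin n)) : Prop :=
  ∀ a b c d : Fin n, T.Adj a b → T.Adj c d → s(a, b) ≠ s(c, d) →
    ∀ x ∈ segment ℝ (circlePt a) (circlePt b) ∩ segment ℝ (circlePt c) (circlePt d),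
      ∃ v : Fin n, v ∈ s(a, b) ∧ v ∈ s(c, d) ∧ x = circlePt v

/-- A graph with linearly ordered vertices is alternating if the neighbors of each vertex are all
larger, or all smaller, than it. -/
def IsAlternating {n : ℕ} (T : SimpleGraph (Fin n)) : Prop :=
  ∀ i : Fin n, (∀ j : Fin n, T.Adj i j → i < j) ∨ (∀ j : Fin n, T.Adj i j → j < i)

/-- The alternating non-crossing trees on `[n]`. -/
def alternatingNonCrossingTrees (n : ℕ) : Set (SimpleGraph (Fin n)) :=
  {T | T.IsTree ∧ IsNonCrossing T ∧ IsAlternating T}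

theorem exists_word {n : ℕ} (π : Equiv.Perm (Fin n)) :
    ∃ l : List (Equiv.Perm (Fin n)),
      l.length = reflLength π ∧ (∀ t ∈ l, t.IsSwap) ∧ l.prod = π := by
  refine Nat.sInf_mem (s := {k : ℕ | ∃ l : List (Equiv.Perm (Fin n)),
    l.length = k ∧ (∀ t ∈ l, t.IsSwap) ∧ l.prod = π}) ?_
  obtain ⟨l, hl⟩ := Equiv.Perm.swapFactors π
  exact ⟨_, l, rfl, hl.2, hl.1⟩

theorem reflLength_prod_le {n : ℕ} (l : List (Equiv.Perm (Fin n))) (hl : ∀ t ∈ l, t.IsSwap) :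
    reflLength l.prod ≤ l.length :=
  Nat.sInf_le ⟨l, rfl, hl, rfl⟩

theorem reflLength_mul_le {n : ℕ} (π σ : Equiv.Perm (Fin n)) :
    reflLength (π * σ) ≤ reflLength π + reflLength σ := by
  obtain ⟨l, h1, h2, h3⟩ := exists_word π
  obtain ⟨l', h1', h2', h3'⟩ := exists_word σ
  have := reflLength_prod_le (l ++ l') (by
    intro t ht
    rcases List.mem_append.1 ht with h | h
    exacts [h2 t h, h2' t h])
  simpa [h1, h1', h3, h3'] using this

theorem reflLength_one (n : ℕ) : reflLength (1 : Equiv.Perm (Fin n)) = 0 := by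
  have := reflLength_prod_le ([] : List (Equiv.Perm (Fin n))) (by simp)
  simpa using this

theorem eq_one_of_reflLength_eq_zero {n : ℕ} {π : Equiv.Perm (Fin n)} (h : reflLength π = 0) :
    π = 1 := by
  obtain ⟨l, h1, h2, h3⟩ := exists_word π
  rw [h, List.length_eq_zero_iff] at h1
  simpa [h1] using h3.symm

theorem swap_inj {α : Type*} [DecidableEq α] {a b c d : α} (hab : a ≠ b)
    (h : Equiv.swap a b = Equiv.swap c d) : s(a, b) = s(c, d) := by
  have h1 : Equiv.swap c d a = b := by rw [← h, Equiv.swap_apply_left]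
  by_cases hc : a = c
  · subst hc; rw [Equiv.swap_apply_left] at h1; rw [h1]
  by_cases hd : a = d
  · subst hd; rw [Equiv.swap_apply_right] at h1; rw [h1, Sym2.eq_swap]
  · rw [Equiv.swap_apply_of_ne_of_ne hc hd] at h1; exact absurd h1 hab

/-- The graph of a list of transpositions. -/
def listGraph {n : ℕ} (l : List (Equiv.Perm (Fin n))) : SimpleGraph (Fin n) where
  Adj a b := a ≠ b ∧ Equiv.swap a b ∈ l
  symm := ⟨fun a b h => ⟨h.1.symm, by rw [Equiv.swap_comm]; exact h.2⟩⟩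
  loopless := ⟨fun a h => h.1 rfl⟩

theorem listGraph_reachable {n : ℕ} (l : List (Equiv.Perm (Fin n))) (hl : ∀ t ∈ l, t.IsSwap) :
    ∀ l' : List (Equiv.Perm (Fin n)), (∀ t ∈ l', t ∈ l) → ∀ x, (listGraph l).Reachable x (l'.prod x)
  | [], _, x => by simp
  | t :: l', h, x => by
    have ih := listGraph_reachable l hl l' (fun t ht => h t (List.mem_cons_of_mem _ ht)) x
    refine ih.trans ?_
    have ht := h t List.mem_cons_self
    obtain ⟨a, b, hab, rfl⟩ := hl t ht
    rw [List.prod_cons, Equiv.Perm.mul_apply]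
    generalize l'.prod x = y
    have had : (listGraph l).Adj a b := ⟨hab, ht⟩
    by_cases hya : y = a
    · subst hya; rw [Equiv.swap_apply_left]; exact had.reachable
    · by_cases hyb : y = b
      · subst hyb; rw [Equiv.swap_apply_right]; exact had.symm.reachable
      · rw [Equiv.swap_apply_of_ne_of_ne hya hyb]

theorem le_length_of_prod_eq {n : ℕ} (l : List (Equiv.Perm (Fin n))) (hl : ∀ t ∈ l, t.IsSwap)
    (hp : l.prod = longCycle n) : n - 1 ≤ l.length := by
  classical
  cases n with
  | zero => simp
  | succ m =>
    have hconn : (listGraph l).Connected := by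
      have h0 : ∀ i : Fin (m + 1), (listGraph l).Reachable 0 i := by
        intro i
        induction i using Fin.induction with
        | zero => rfl
        | succ i ih =>
          refine ih.trans ?_
          have := listGraph_reachable l hl l (fun _ h => h) i.castSucc
          rwa [hp, longCycle, finRotate_apply, Fin.coeSucc_eq_succ] at this
      exact ⟨fun a b => (h0 a).symm.trans (h0 b)⟩
    have h1 := hconn.card_vert_le_card_edgeSet_add_one
    have h2 : Nat.card (listGraph l).edgeSet ≤ l.length := by
      rw [Nat.card_coe_set_eq]
      refine le_trans ?_ (List.toFinset_card_le l)
      rw [← Set.ncard_coe_finset]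
      refine Set.ncard_le_ncard_of_injOn
        (fun s => Sym2.lift ⟨fun a b => Equiv.swap a b, fun a b => Equiv.swap_comm a b⟩ s) ?_ ?_
      · intro s
        induction s using Sym2.ind with
        | _ a b => intro h; simpa using h.2
      · intro s hs s' hs'
        induction s using Sym2.ind with
        | _ a b =>
          induction s' using Sym2.ind with
          | _ c d => intro h; exact swap_inj hs.1 h
    rw [Nat.card_fin] at h1
    omega

theorem AbsLE.trans {n : ℕ} {π σ τ : Equiv.Perm (Fin n)} (h1 : AbsLE π σ) (h2 : AbsLE σ τ) :
    AbsLE π τ := by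
  unfold AbsLE at *
  have h3 := reflLength_mul_le (π⁻¹ * σ) (σ⁻¹ * τ)
  have h4 := reflLength_mul_le π (π⁻¹ * τ)
  rw [show π⁻¹ * σ * (σ⁻¹ * τ) = π⁻¹ * τ by group] at h3
  rw [show π * (π⁻¹ * τ) = τ by group] at h4
  omega

theorem AbsLE.refl {n : ℕ} (π : Equiv.Perm (Fin n)) : AbsLE π π := by
  simp [AbsLE, reflLength_one]

theorem AbsLE.eq_of_le {n : ℕ} {π σ : Equiv.Perm (Fin n)} (h : AbsLE π σ)
    (h' : reflLength σ ≤ reflLength π) : π = σ := by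
  unfold AbsLE at h
  have : π⁻¹ * σ = 1 := eq_one_of_reflLength_eq_zero (by omega)
  exact inv_mul_eq_one.1 this

theorem AbsLE.le {n : ℕ} {π σ : Equiv.Perm (Fin n)} (h : AbsLE π σ) :
    reflLength π ≤ reflLength σ := by
  unfold AbsLE at h; omega

theorem reflLength_longCycle (n : ℕ) : reflLength (longCycle n) = n - 1 := by
  refine le_antisymm ?_ ?_
  · have := reflLength_prod_le (e n).word (e n).isSwap
    rwa [(e n).prod_word, (e n).length_word] at this
  · obtain ⟨l, h1, h2, h3⟩ := exists_word (longCycle n)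
    rw [← h1]
    exact le_length_of_prod_eq l h2 h3

section chain
variable {n : ℕ} (v : F n)

theorem F.chainElt_zero : v.chainElt 0 = 1 := by simp [F.chainElt]

theorem F.chainElt_of_ge {k : ℕ} (h : n - 1 ≤ k) : v.chainElt k = longCycle n := by
  rw [F.chainElt, List.take_of_length_le (by rw [v.length_word]; exact h), v.prod_word]

theorem F.chainElt_succ {k : ℕ} (h : k < v.word.length) :
    v.chainElt (k + 1) = v.chainElt k * v.word[k] := by
  exact List.prod_take_succ _ _ h

theorem F.reflLength_quot_le {k m : ℕ} (h : k ≤ m) :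
    reflLength ((v.chainElt k)⁻¹ * v.chainElt m) ≤ m - k := by
  have h1 : v.chainElt m = v.chainElt k * ((v.word.take m).drop k).prod := by
    rw [F.chainElt, F.chainElt, ← List.prod_append]
    conv_lhs => rw [← List.take_append_drop k (v.word.take m)]
    rw [List.take_take, min_eq_left h]
  rw [h1, inv_mul_cancel_left]
  refine (reflLength_prod_le _ fun t ht => ?_).trans ?_
  · exact v.isSwap t (List.mem_of_mem_take (List.mem_of_mem_drop ht))
  · rw [List.length_drop, List.length_take]; omega

theorem F.reflLength_quot {k m : ℕ} (h : k ≤ m) (hm : m ≤ n - 1) :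
    reflLength ((v.chainElt k)⁻¹ * v.chainElt m) = m - k := by
  have h1 := v.reflLength_quot_le (Nat.zero_le k)
  have h2 := v.reflLength_quot_le h
  have h3 := v.reflLength_quot_le hm
  have h4 := reflLength_mul_le (v.chainElt k)
    ((v.chainElt k)⁻¹ * v.chainElt m * ((v.chainElt m)⁻¹ * v.chainElt (n - 1)))
  have h5 := reflLength_mul_le ((v.chainElt k)⁻¹ * v.chainElt m)
    ((v.chainElt m)⁻¹ * v.chainElt (n - 1))
  rw [show v.chainElt k * ((v.chainElt k)⁻¹ * v.chainElt m *
    ((v.chainElt m)⁻¹ * v.chainElt (n - 1))) = v.chainElt (n - 1) by group,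
    v.chainElt_of_ge le_rfl, reflLength_longCycle] at h4
  rw [v.chainElt_zero, inv_one, one_mul] at h1
  rw [v.chainElt_of_ge le_rfl] at h3 h5
  omega

theorem F.reflLength_chainElt {k : ℕ} (hk : k ≤ n - 1) : reflLength (v.chainElt k) = k := by
  have := v.reflLength_quot (Nat.zero_le k) hk
  rwa [v.chainElt_zero, inv_one, one_mul, Nat.sub_zero] at this

theorem F.absLE_chainElt {k m : ℕ} (h : k ≤ m) (hm : m ≤ n - 1) :
    AbsLE (v.chainElt k) (v.chainElt m) := by
  unfold AbsLE
  rw [v.reflLength_quot h hm, v.reflLength_chainElt hm, v.reflLength_chainElt (h.trans hm)]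
  omega

theorem F.mem_chain_iff {π : Equiv.Perm (Fin n)} :
    π ∈ v.chain ↔ ∃ k ≤ n - 1, v.chainElt k = π := by
  constructor
  · rintro ⟨k, rfl⟩
    rcases le_total k (n - 1) with h | h
    · exact ⟨k, h, rfl⟩
    · exact ⟨n - 1, le_rfl, by rw [v.chainElt_of_ge le_rfl, v.chainElt_of_ge h]⟩
  · rintro ⟨k, -, rfl⟩; exact ⟨k, rfl⟩

theorem F.mem_chain_iff' {π : Equiv.Perm (Fin n)} :
    π ∈ v.chain ↔ reflLength π ≤ n - 1 ∧ v.chainElt (reflLength π) = π := by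
  rw [v.mem_chain_iff]
  constructor
  · rintro ⟨k, hk, rfl⟩
    rw [v.reflLength_chainElt hk]; exact ⟨hk, rfl⟩
  · rintro ⟨h, h'⟩; exact ⟨_, h, h'⟩

theorem F.isMaximalChainNC : IsMaximalChainNC v.chain := by
  refine ⟨⟨?_, ?_⟩, ?_⟩
  · intro π hπ
    obtain ⟨k, hk, rfl⟩ := v.mem_chain_iff.1 hπ
    have := v.absLE_chainElt hk le_rfl
    rwa [v.chainElt_of_ge le_rfl] at this
  · intro π hπ σ hσ _
    obtain ⟨k, hk, rfl⟩ := v.mem_chain_iff.1 hπ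
    obtain ⟨m, hm, rfl⟩ := v.mem_chain_iff.1 hσ
    rcases le_total k m with h | h
    · exact Or.inl (v.absLE_chainElt h hm)
    · exact Or.inr (v.absLE_chainElt h hk)
  · rintro D ⟨hD, hDc⟩ hle π hπ
    have hl : reflLength π ≤ n - 1 := by
      have : AbsLE π (longCycle n) := hD hπ
      exact this.le.trans (reflLength_longCycle n).le
    rw [v.mem_chain_iff']
    refine ⟨hl, ?_⟩
    by_contra hne
    have hmem : v.chainElt (reflLength π) ∈ D := hle ⟨_, rfl⟩
    have hlen := v.reflLength_chainElt hl
    rcases hDc hmem hπ hne with h | h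
    · exact hne (h.eq_of_le hlen.ge)
    · exact hne (h.eq_of_le hlen.le).symm

theorem F.ext_chainElt {u v : F n} (h : ∀ k ≤ n - 1, u.chainElt k = v.chainElt k) : u = v := by
  ext1
  refine List.ext_getElem (by rw [u.length_word, v.length_word]) fun k hu hv => ?_
  have hk : k < n - 1 := by rw [← u.length_word]; exact hu
  have h1 := h (k + 1) hk
  rw [F.chainElt_succ u hu, F.chainElt_succ v hv, h k hk.le] at h1
  exact mul_left_cancel h1

theorem mem_of_comparable {C : Set (Equiv.Perm (Fin n))} (hC : IsMaximalChainNC C)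
    {π : Equiv.Perm (Fin n)} (hπ : π ∈ NC n) (h : ∀ σ ∈ C, AbsLE π σ ∨ AbsLE σ π) : π ∈ C := by
  have := hC.2 (y := insert π C) ⟨Set.insert_subset hπ hC.1.1,
    hC.1.2.insert fun σ hσ _ => h σ hσ⟩ (Set.subset_insert _ _)
  exact this (Set.mem_insert _ _)

theorem exists_mem_reflLength {C : Set (Equiv.Perm (Fin n))} (hC : IsMaximalChainNC C)
    {k : ℕ} (hk : k ≤ n - 1) : ∃ π ∈ C, reflLength π = k := by
  by_contra! hno
  have hone : (1 : Equiv.Perm (Fin n)) ∈ C := by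
    have h1 : ∀ σ : Equiv.Perm (Fin n), AbsLE 1 σ := fun σ => by simp [AbsLE, reflLength_one]
    exact mem_of_comparable hC (h1 _) fun σ _ => Or.inl (h1 σ)
  have hc : longCycle n ∈ C :=
    mem_of_comparable hC (AbsLE.refl _) fun σ hσ => Or.inr (hC.1.1 hσ)
  have hk0 : 0 < k := by
    have := hno _ hone; rw [reflLength_one] at this; omega
  have hk1 : k < n - 1 := by
    have := hno _ hc; rw [reflLength_longCycle] at this; omega
  obtain ⟨π, ⟨hπC, hπk⟩, hπ⟩ := Set.exists_max_image {σ | σ ∈ C ∧ reflLength σ < k} reflLength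
    (Set.toFinite _) ⟨1, hone, by rw [reflLength_one]; exact hk0⟩
  obtain ⟨τ, ⟨hτC, hτk⟩, hτ⟩ := Set.exists_min_image {σ | σ ∈ C ∧ k < reflLength σ} reflLength
    (Set.toFinite _) ⟨_, hc, by rw [reflLength_longCycle]; exact hk1⟩
  have hle : ∀ σ ∈ C, ∀ σ' ∈ C, reflLength σ ≤ reflLength σ' → AbsLE σ σ' := by
    intro σ h σ' h' hl
    by_cases he : σ = σ'
    · rw [he]; exact AbsLE.refl _
    rcases hC.1.2 h h' he with h2 | h2
    · exact h2
    · exact absurd (h2.eq_of_le hl).symm he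
  have hπτ := hle π hπC τ hτC (by omega)
  obtain ⟨l, hl1, hl2, hl3⟩ := exists_word (π⁻¹ * τ)
  have hπτ' : reflLength π + reflLength (π⁻¹ * τ) = reflLength τ := hπτ
  set x := π * (l.take (k - reflLength π)).prod with hx
  have hxq : reflLength (π⁻¹ * x) ≤ k - reflLength π := by
    rw [hx, inv_mul_cancel_left]
    refine (reflLength_prod_le _ fun t ht => hl2 t (List.mem_of_mem_take ht)).trans ?_
    rw [List.length_take]; omega
  have hxt : reflLength (x⁻¹ * τ) ≤ reflLength τ - k := by
    have : x⁻¹ * τ = (l.drop (k - reflLength π)).prod := by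
      rw [inv_mul_eq_iff_eq_mul, hx, mul_assoc, ← List.prod_append, List.take_append_drop, hl3]
      group
    rw [this]
    refine (reflLength_prod_le _ fun t ht => hl2 t (List.mem_of_mem_drop ht)).trans ?_
    rw [List.length_drop]; omega
  have h1 := reflLength_mul_le π (π⁻¹ * x)
  have h2 := reflLength_mul_le x (x⁻¹ * τ)
  rw [mul_inv_cancel_left] at h1 h2
  have hxk : reflLength x = k := by omega
  have hπx : AbsLE π x := by unfold AbsLE; omega
  have hxτ : AbsLE x τ := by unfold AbsLE; omega
  refine hno x (mem_of_comparable hC (hxτ.trans (hC.1.1 hτC)) fun σ hσ => ?_) hxk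
  rcases lt_or_gt_of_ne (hno σ hσ) with h | h
  · exact Or.inr ((hle σ hσ π hπC (hπ σ ⟨hσ, h⟩)).trans hπx)
  · exact Or.inl (hxτ.trans (hle τ hτC σ hσ (hτ σ ⟨hσ, h⟩)))

/-- Factorizations of the long cycle correspond bijectively to maximal chains of `NC(n)`. -/
theorem bijOn_chain (n : ℕ) :
    Set.BijOn (fun v : F n => v.chain) Set.univ
      {C : Set (Equiv.Perm (Fin n)) | IsMaximalChainNC C} := by
  refine ⟨fun v _ => v.isMaximalChainNC, fun u _ v _ h => ?_, fun C hC => ?_⟩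
  · refine F.ext_chainElt fun k hk => ?_
    have hm : u.chainElt k ∈ v.chain := by
      rw [← show u.chain = v.chain from h]; exact ⟨k, rfl⟩
    have := (v.mem_chain_iff'.1 hm).2
    rwa [u.reflLength_chainElt hk, eq_comm] at this
  · have hC' : IsMaximalChainNC C := hC
    have hex : ∀ k, ∃ π ∈ C, reflLength π = min k (n - 1) :=
      fun k => exists_mem_reflLength hC' (min_le_right _ _)
    choose p hpC hpl using hex
    have hone : p 0 = 1 := eq_one_of_reflLength_eq_zero (by rw [hpl]; simp)
    have hlast : p (n - 1) = longCycle n := by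
      have h : AbsLE (p (n - 1)) (longCycle n) := hC'.1.1 (hpC _)
      exact h.eq_of_le (by rw [hpl, reflLength_longCycle]; simp)
    have huniq : ∀ σ ∈ C, p (reflLength σ) = σ := by
      intro σ hσ
      have hσl : reflLength σ ≤ n - 1 := by
        have h : AbsLE σ (longCycle n) := hC'.1.1 hσ
        exact h.le.trans (reflLength_longCycle n).le
      have hl : reflLength (p (reflLength σ)) = reflLength σ := by rw [hpl]; simpa using hσl
      by_contra hne
      rcases hC'.1.2 (hpC _) hσ hne with h | h
      · exact hne (h.eq_of_le hl.ge)
      · exact hne (h.eq_of_le hl.le).symm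
    have hstep : ∀ k < n - 1, ((p k)⁻¹ * p (k + 1)).IsSwap := by
      intro k hk
      have h1 : reflLength (p k) = k := by rw [hpl]; omega
      have h2 : reflLength (p (k + 1)) = k + 1 := by rw [hpl]; omega
      have hne : p k ≠ p (k + 1) := fun h => by rw [h] at h1; omega
      have hle : AbsLE (p k) (p (k + 1)) := by
        rcases hC'.1.2 (hpC k) (hpC (k + 1)) hne with h | h
        · exact h
        · have := h.le; omega
      unfold AbsLE at hle
      obtain ⟨l, hl1, hl2, hl3⟩ := exists_word ((p k)⁻¹ * p (k + 1))
      obtain ⟨t, rfl⟩ := List.length_eq_one_iff.1 (show l.length = 1 by omega)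
      rw [← hl3, List.prod_singleton]
      exact hl2 t (by simp)
    have hprod : ∀ k, (List.ofFn fun i : Fin k => (p i)⁻¹ * p (i + 1)).prod = p k := by
      intro k
      induction k with
      | zero => simp [hone]
      | succ k ih =>
        rw [List.ofFn_succ', List.concat_eq_append, List.prod_append, List.prod_singleton]
        simp only [Fin.val_castSucc, Fin.val_last]
        rw [ih, mul_inv_cancel_left]
    let v : F n :=
      { word := List.ofFn fun i : Fin (n - 1) => (p i)⁻¹ * p (i + 1)
        length_word := by simp
        isSwap := by
          intro t ht
          obtain ⟨i, rfl⟩ := List.mem_ofFn.1 ht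
          exact hstep i i.2
        prod_word := by rw [hprod, hlast] }
    have hv : ∀ k ≤ n - 1, v.chainElt k = p k := by
      intro k
      induction k with
      | zero => intro _; rw [v.chainElt_zero, hone]
      | succ k ih =>
        intro hk
        have hk' : k < v.word.length := by rw [v.length_word]; omega
        rw [v.chainElt_succ hk', ih (by omega)]
        simp [v]
    refine ⟨v, trivial, ?_⟩
    ext σ
    change σ ∈ v.chain ↔ σ ∈ C
    rw [v.mem_chain_iff]
    constructor
    · rintro ⟨k, hk, rfl⟩; rw [hv k hk]; exact hpC k
    · intro hσ
      have h : AbsLE σ (longCycle n) := hC'.1.1 hσ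
      have hl := h.le.trans (reflLength_longCycle n).le
      exact ⟨_, hl, by rw [hv _ hl, huniq σ hσ]⟩

/-- Adjacency in the Hurwitz graph in terms of the maximal chains as sets (of the same size). -/
theorem hurwitzGraph_adj_iff_ncard {n : ℕ} (u v : F n) :
    (hurwitzGraph n).Adj u v ↔ (u.chain \ v.chain).ncard = 1 := by
  have key : ∀ π, π ∈ u.chain \ v.chain ↔
      ∃ k, u.chainElt k ≠ v.chainElt k ∧ u.chainElt k = π := by
    intro π
    constructor
    · rintro ⟨h1, h2⟩
      obtain ⟨k, hk, rfl⟩ := u.mem_chain_iff.1 h1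
      exact ⟨k, fun h => h2 ⟨k, h.symm⟩, rfl⟩
    · rintro ⟨k, hk, rfl⟩
      have hk1 : k ≤ n - 1 := by
        by_contra h
        exact hk (by rw [u.chainElt_of_ge (by omega), v.chainElt_of_ge (by omega)])
      refine ⟨⟨k, rfl⟩, fun h => hk ?_⟩
      have := (v.mem_chain_iff'.1 h).2
      rwa [u.reflLength_chainElt hk1, eq_comm] at this
  have hle : ∀ k, u.chainElt k ≠ v.chainElt k → k ≤ n - 1 := by
    intro k hk
    by_contra h
    exact hk (by rw [u.chainElt_of_ge (by omega), v.chainElt_of_ge (by omega)])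
  rw [Set.ncard_eq_one]
  constructor
  · rintro ⟨k, hk, huq⟩
    refine ⟨u.chainElt k, Set.ext fun π => (key π).trans ⟨?_, ?_⟩⟩
    · rintro ⟨m, hm, rfl⟩; rw [huq m hm]; rfl
    · rintro rfl; exact ⟨k, hk, rfl⟩
  · rintro ⟨π, hπ⟩
    obtain ⟨k, hk, hkπ⟩ := (key π).1 (by rw [hπ]; rfl)
    refine ⟨k, hk, fun m hm => ?_⟩
    have hm' : u.chainElt m ∈ u.chain \ v.chain := (key _).2 ⟨m, hm, rfl⟩
    rw [hπ, Set.mem_singleton_iff, ← hkπ] at hm'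
    rw [← u.reflLength_chainElt (hle m hm), hm', u.reflLength_chainElt (hle k hk)]

end chain

/-- Twice the signed area of a triangle. -/
def area2 (p q r : ℂ) : ℝ := (q.re - p.re) * (r.im - p.im) - (q.im - p.im) * (r.re - p.re)

theorem area2_circlePt_pos {n : ℕ} {a b c : Fin n} (hab : a < b) (hbc : b < c) :
    0 < area2 (circlePt a) (circlePt b) (circlePt c) := by
  have hn : (0 : ℝ) < n := by exact_mod_cast lt_of_le_of_lt (Nat.zero_le _) a.2
  set u : ℝ := Real.pi * ((b : ℕ) - (a : ℕ)) / n with hu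
  set w : ℝ := Real.pi * ((c : ℕ) - (b : ℕ)) / n with hw
  set t : ℝ := 2 * Real.pi * (a : ℕ) / n with ht
  have hab' : ((a : ℕ) : ℝ) < (b : ℕ) := by exact_mod_cast hab
  have hbc' : ((b : ℕ) : ℝ) < (c : ℕ) := by exact_mod_cast hbc
  have hc : ((c : ℕ) : ℝ) < n := by exact_mod_cast c.2
  have ha : (0 : ℝ) ≤ (a : ℕ) := Nat.cast_nonneg _
  have hb2 : 2 * Real.pi * (b : ℕ) / n = t + 2 * u := by rw [hu, ht]; ring
  have hc2 : 2 * Real.pi * (c : ℕ) / n = t + 2 * (u + w) := by rw [hu, ht, hw]; ring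
  have hupos : 0 < u := by
    have : (0 : ℝ) < (b : ℕ) - (a : ℕ) := by linarith
    have := Real.pi_pos
    positivity
  have hwpos : 0 < w := by
    have : (0 : ℝ) < (c : ℕ) - (b : ℕ) := by linarith
    have := Real.pi_pos
    positivity
  have huw : u + w < Real.pi := by
    have : u + w = Real.pi * (((c : ℕ) - (a : ℕ)) / n) := by rw [hu, hw]; ring
    rw [this]
    have h1 : (((c : ℕ) : ℝ) - (a : ℕ)) / n < 1 := by rw [div_lt_one hn]; linarith
    nlinarith [Real.pi_pos]
  have key : area2 (circlePt a) (circlePt b) (circlePt c) =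
      4 * Real.sin u * Real.sin w * Real.sin (u + w) := by
    simp only [area2, circlePt, Complex.exp_ofReal_mul_I_re, Complex.exp_ofReal_mul_I_im]
    have h1 : ∀ α β γ : ℝ, (Real.cos β - Real.cos α) * (Real.sin γ - Real.sin α) -
        (Real.sin β - Real.sin α) * (Real.cos γ - Real.cos α) =
        Real.sin (β - α) + Real.sin (γ - β) - Real.sin (γ - α) := by
      intro α β γ; simp only [Real.sin_sub]; ring
    rw [hb2, hc2, ← ht, h1, show t + 2 * u - t = 2 * u by ring,
      show t + 2 * (u + w) - (t + 2 * u) = 2 * w by ring,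
      show t + 2 * (u + w) - t = 2 * u + 2 * w by ring]
    simp only [Real.sin_add, Real.cos_two_mul, Real.sin_two_mul]
    have e2 := Real.sin_sq_add_cos_sq u
    have e3 := Real.sin_sq_add_cos_sq w
    linear_combination (-4 * Real.sin w * Real.cos w) * e2 - 4 * Real.sin u * Real.cos u * e3
  rw [key]
  have s1 := Real.sin_pos_of_pos_of_lt_pi hupos (by linarith)
  have s2 := Real.sin_pos_of_pos_of_lt_pi hwpos (by linarith)
  have s3 := Real.sin_pos_of_pos_of_lt_pi (by linarith : 0 < u + w) huw
  positivity

/-- The combinatorial form of the non-crossing condition. -/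
theorem isNonCrossing_iff {n : ℕ} (T : SimpleGraph (Fin n)) :
    IsNonCrossing T ↔
      ∀ a b c d : Fin n, a < b → b < c → c < d → ¬ (T.Adj a c ∧ T.Adj b d) := by
  constructor
  · rintro h a b c d hab hbc hcd ⟨hac, hbd⟩
    have A1 := area2_circlePt_pos hbc hcd
    have A2 := area2_circlePt_pos hab (hbc.trans hcd)
    have A3 := area2_circlePt_pos (hab.trans hbc) hcd
    have A4 := area2_circlePt_pos hab hbc
    have hsum : area2 (circlePt b) (circlePt c) (circlePt d) +
        area2 (circlePt a) (circlePt b) (circlePt d) =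
        area2 (circlePt a) (circlePt c) (circlePt d) +
        area2 (circlePt a) (circlePt b) (circlePt c) := by
      simp only [area2]; ring
    have hre : area2 (circlePt b) (circlePt c) (circlePt d) * (circlePt a).re +
        area2 (circlePt a) (circlePt b) (circlePt d) * (circlePt c).re =
        area2 (circlePt a) (circlePt c) (circlePt d) * (circlePt b).re +
        area2 (circlePt a) (circlePt b) (circlePt c) * (circlePt d).re := by
      simp only [area2]; ring
    have him : area2 (circlePt b) (circlePt c) (circlePt d) * (circlePt a).im +
        area2 (circlePt a) (circlePt b) (circlePt d) * (circlePt c).im =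
        area2 (circlePt a) (circlePt c) (circlePt d) * (circlePt b).im +
        area2 (circlePt a) (circlePt b) (circlePt c) * (circlePt d).im := by
      simp only [area2]; ring
    generalize area2 (circlePt b) (circlePt c) (circlePt d) = w1 at *
    generalize area2 (circlePt a) (circlePt b) (circlePt d) = w2 at *
    generalize area2 (circlePt a) (circlePt c) (circlePt d) = w3 at *
    generalize area2 (circlePt a) (circlePt b) (circlePt c) = w4 at *
    have hne : s(a, c) ≠ s(b, d) := by
      rw [Ne, Sym2.eq_iff]; rintro (⟨rfl, -⟩ | ⟨rfl, -⟩)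
      · exact lt_irrefl _ hab
      · exact lt_irrefl _ (hab.trans (hbc.trans hcd))
    have hx := h a c b d hac hbd hne
      ((w1 / (w1 + w2)) • circlePt a + (w2 / (w1 + w2)) • circlePt c)
      ⟨⟨_, _, by positivity, by positivity, by field_simp, rfl⟩,
        ⟨w3 / (w1 + w2), w4 / (w1 + w2), by positivity, by positivity, by
          rw [← add_div, ← hsum]; exact div_self (by positivity), by
          apply Complex.ext
          · simp only [Complex.add_re, Complex.smul_re, smul_eq_mul]
            field_simp; linarith
          · simp only [Complex.add_im, Complex.smul_im, smul_eq_mul]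
            field_simp; linarith⟩⟩
    obtain ⟨v, hv1, hv2, -⟩ := hx
    rw [Sym2.mem_iff] at hv1 hv2
    rcases hv1 with rfl | rfl <;> rcases hv2 with rfl | rfl
    · exact lt_irrefl _ hab
    · exact lt_irrefl _ (hab.trans (hbc.trans hcd))
    · exact lt_irrefl _ hbc
    · exact lt_irrefl _ hcd
  · intro h
    have main : ∀ a b c d : Fin n, a < b → T.Adj a b → T.Adj c d → s(a, b) ≠ s(c, d) →
        ∀ x ∈ segment ℝ (circlePt a) (circlePt b) ∩ segment ℝ (circlePt c) (circlePt d),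
          ∃ v : Fin n, v ∈ s(a, b) ∧ v ∈ s(c, d) ∧ x = circlePt v := by
      rintro a b c d hlt hab hcd hne x ⟨⟨s, t, hs, ht, hst, rfl⟩, ⟨s', t', hs', ht', hst', hx⟩⟩
      have hpos : ∀ z : Fin n, z < a ∨ b < z →
          0 < area2 (circlePt a) (circlePt b) (circlePt z) := by
        rintro z (hz | hz)
        · have := area2_circlePt_pos hz hlt
          simp only [area2] at this ⊢; linarith
        · exact area2_circlePt_pos hlt hz
      have hneg : ∀ z : Fin n, a < z → z < b →
          area2 (circlePt a) (circlePt b) (circlePt z) < 0 := by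
        intro z h1 h2
        have := area2_circlePt_pos h1 h2
        simp only [area2] at this ⊢; linarith
      have hzero : s' * area2 (circlePt a) (circlePt b) (circlePt c) +
          t' * area2 (circlePt a) (circlePt b) (circlePt d) = 0 := by
        have h1 := congrArg Complex.re hx
        have h2 := congrArg Complex.im hx
        simp only [Complex.add_re, Complex.add_im, Complex.smul_re, Complex.smul_im,
          smul_eq_mul] at h1 h2
        obtain rfl : s = 1 - t := by linarith
        obtain rfl : s' = 1 - t' := by linarith
        simp only [area2]
        linear_combination ((circlePt b).re - (circlePt a).re) * h2 -
          ((circlePt b).im - (circlePt a).im) * h1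
      have hcase : ∀ z : Fin n, (z = a ∨ z = b) ∨ (z < a ∨ b < z) ∨ (a < z ∧ z < b) := by
        intro z; omega
      have hc_in : (c = a ∨ c = b) → t' = 0 →
          ∃ v : Fin n, v ∈ s(a, b) ∧ v ∈ s(c, d) ∧
            s • circlePt a + t • circlePt b = circlePt v := by
        intro h1 h2
        refine ⟨c, Sym2.mem_iff.2 h1, Sym2.mem_mk_left _ _, ?_⟩
        rw [← hx, h2, show s' = 1 by linarith]; simp
      have hd_in : (d = a ∨ d = b) → s' = 0 →
          ∃ v : Fin n, v ∈ s(a, b) ∧ v ∈ s(c, d) ∧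
            s • circlePt a + t • circlePt b = circlePt v := by
        intro h1 h2
        refine ⟨d, Sym2.mem_iff.2 h1, Sym2.mem_mk_right _ _, ?_⟩
        rw [← hx, h2, show t' = 1 by linarith]; simp
      have hz0 : ∀ z : Fin n, (z = a ∨ z = b) →
          area2 (circlePt a) (circlePt b) (circlePt z) = 0 := by
        rintro z (rfl | rfl) <;> simp only [area2] <;> ring
      have hcd_ne : c ≠ d := hcd.ne
      rcases hcase c with h1 | h1 | h1 <;> rcases hcase d with h2 | h2 | h2
      · refine absurd ?_ hne
        rw [Sym2.eq_iff]
        rcases h1 with rfl | rfl <;> rcases h2 with rfl | rfl <;> simp_all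
      · have := hpos d h2
        rw [hz0 c h1] at hzero
        exact hc_in h1 (by
          rcases mul_eq_zero.1 (by linarith : t' * _ = 0) with h | h
          · exact h
          · exact absurd h this.ne')
      · have := hneg d h2.1 h2.2
        rw [hz0 c h1] at hzero
        exact hc_in h1 (by
          rcases mul_eq_zero.1 (by linarith : t' * _ = 0) with h | h
          · exact h
          · exact absurd h this.ne)
      · have := hpos c h1
        rw [hz0 d h2] at hzero
        exact hd_in h2 (by
          rcases mul_eq_zero.1 (by linarith : s' * _ = 0) with h | h
          · exact h
          · exact absurd h this.ne')
      · have p1 := hpos c h1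
        have p2 := hpos d h2
        rcases hs'.eq_or_lt with h0 | h0
        · obtain rfl : t' = 1 := by linarith
          rw [← h0] at hzero; linarith
        · linarith [mul_pos h0 p1, mul_nonneg ht' p2.le]
      · exfalso
        rcases h1 with h1 | h1
        · exact h c a d b h1 h2.1 h2.2 ⟨hcd, hab⟩
        · exact h a d b c h2.1 h2.2 h1 ⟨hab, hcd.symm⟩
      · have := hneg c h1.1 h1.2
        rw [hz0 d h2] at hzero
        exact hd_in h2 (by
          rcases mul_eq_zero.1 (by linarith : s' * _ = 0) with h | h
          · exact h
          · exact absurd h this.ne)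
      · exfalso
        rcases h2 with h2 | h2
        · exact h d a c b h2 h1.1 h1.2 ⟨hcd.symm, hab⟩
        · exact h a c b d h1.1 h1.2 h2 ⟨hab, hcd⟩
      · have p1 := hneg c h1.1 h1.2
        have p2 := hneg d h2.1 h2.2
        rcases hs'.eq_or_lt with h0 | h0
        · obtain rfl : t' = 1 := by linarith
          rw [← h0] at hzero; linarith
        · linarith [mul_neg_of_pos_of_neg h0 p1, mul_nonpos_of_nonneg_of_nonpos ht' p2.le]
    intro a b c d hab hcd hne x hx
    rcases lt_or_gt_of_ne hab.ne with hlt | hlt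
    · exact main a b c d hlt hab hcd hne x hx
    · rw [Sym2.eq_swap] at hne ⊢
      rw [segment_symm ℝ (circlePt a)] at hx
      exact main b a c d hlt hab.symm hcd hne x hx

end HurwitzWeak

/-! Count excedances. Call `y` an excedance value of `π` if `π⁻¹ y < y`. Right multiplication by `(a
b)` with `a < b` moves the preimage of `π b` down and that of `π a` up, so it adds at most one such
value, namely `π b`. The identity has none and the long cycle has `n - 1`, so in a factorization of
`c` into `n - 1` transpositions every letter creates exactly one (`F.steps`). The value created is
the label of the letter. Created values are never lost, so the labels of a chain are a permutation
of `1, …, n - 1`.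

The labels turn the Hurwitz graph into a problem about sorting. An edge changes two consecutive
letters, hence at most exchanges two consecutive labels (`labels_of_adj`); conversely, every such
exchange is realized by an edge (`exists_exchange`, `exists_adj_exchange`). Only `e` has increasing
labels, so the distance from `e` is the number of inversions of the labels (`dist_e_eq`), and the
maximal elements are exactly the chains with decreasing labels (`isWeakMax_iff`).

It remains to match these chains with trees. The graph of any factorization of `c` is a non-crossing
tree (`graph_isTree`, `graph_isNonCrossing`), and decreasing labels make it alternating
(`graph_isAlternating`). A chain with decreasing labels is recovered from its graph by reading the
word from its end (`Steps.eq_of_labels_eq`). For surjectivity, the edges of an alternating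
non-crossing tree, in a suitable order, form some factorization (`exists_graph_eq`). Its ascents are
then removed one at a time: in an alternating graph the two letters at an ascent must commute, so
the graph does not change (`exists_pairwise_gt_of_isAlternating`).

The factor `(1, n)` comes from the tree: no edge can leave the interval between the first vertex and
its largest neighbor (`zero_adj_last`). -/

namespace HurwitzWeak

open Equiv

/-! ### Excedances and how a transposition changes them -/

section Excedances
variable {n : ℕ}

/-- The excedance values of a permutation. -/
def excValues (π : Perm (Fin n)) : Finset (Fin n) :=
  Finset.univ.filter fun y => π.symm y < y

theorem mem_excValues {π : Perm (Fin n)} {y : Fin n} : y ∈ excValues π ↔ π.symm y < y := by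
  simp [excValues]

theorem apply_mem_excValues {π : Perm (Fin n)} {i : Fin n} : π i ∈ excValues π ↔ i < π i := by
  simp [mem_excValues]

/-- Multiplying `π` on the right by `(a b)` creates a new excedance, with value `π b`. -/
structure IsStep (π : Perm (Fin n)) (a b : Fin n) : Prop where
  lt : a < b
  lt_apply : a < π b
  apply_le : π b ≤ b
  lt_of_lt : a < π a → b < π a

theorem mem_excValues_mul_swap {π : Perm (Fin n)} {a b y : Fin n} :
    y ∈ excValues (π * swap a b) ↔ swap a b (π.symm y) < y := by
  rw [mem_excValues]; rfl

/-- The preimage of `π a` moves up from `a` to `b`, so this value can only be lost; the preimage of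
`π b` moves down, so only this value can be gained. -/
theorem excValues_mul_swap_subset (π : Perm (Fin n)) {a b : Fin n} (h : a < b) :
    excValues (π * swap a b) ⊆ insert (π b) (excValues π) := by
  intro y hy
  obtain ⟨i, rfl⟩ := π.surjective y
  rw [mem_excValues_mul_swap, symm_apply_apply] at hy
  rw [Finset.mem_insert, apply_mem_excValues]
  by_cases hb : i = b
  · exact Or.inl (by rw [hb])
  · right
    by_cases ha : i = a
    · subst ha; rw [swap_apply_left] at hy; exact h.trans hy
    · rwa [swap_apply_of_ne_of_ne ha hb] at hy

theorem card_excValues_mul_swap_le (π : Perm (Fin n)) {a b : Fin n} (h : a < b) :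
    (excValues (π * swap a b)).card ≤ (excValues π).card + 1 :=
  (Finset.card_le_card (excValues_mul_swap_subset π h)).trans (Finset.card_insert_le _ _)

/-- A gain of one means that `π b` is new and that `π a`, the only value at risk, is not lost; the
fields of `IsStep` express this. -/
theorem isStep_of_card {π : Perm (Fin n)} {a b : Fin n} (h : a < b)
    (hc : (excValues (π * swap a b)).card = (excValues π).card + 1) : IsStep π a b := by
  have hsub := excValues_mul_swap_subset π h
  have heq : excValues (π * swap a b) = insert (π b) (excValues π) :=
    Finset.eq_of_subset_of_card_le hsub (by rw [hc]; exact Finset.card_insert_le _ _)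
  have hb : π b ∉ excValues π := by
    intro hb
    rw [Finset.insert_eq_of_mem hb] at heq
    rw [heq] at hc
    omega
  refine ⟨h, ?_, ?_, fun ha => ?_⟩
  · have : π b ∈ excValues (π * swap a b) := by rw [heq]; exact Finset.mem_insert_self _ _
    rwa [mem_excValues_mul_swap, symm_apply_apply, swap_apply_right] at this
  · rwa [apply_mem_excValues, not_lt] at hb
  · have : π a ∈ excValues (π * swap a b) := by
      rw [heq]; exact Finset.mem_insert_of_mem (apply_mem_excValues.2 ha)
    rwa [mem_excValues_mul_swap, symm_apply_apply, swap_apply_left] at this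

theorem IsStep.notMem {π : Perm (Fin n)} {a b : Fin n} (h : IsStep π a b) :
    π b ∉ excValues π := by
  rw [apply_mem_excValues, not_lt]; exact h.apply_le

theorem IsStep.excValues_eq {π : Perm (Fin n)} {a b : Fin n} (h : IsStep π a b) :
    excValues (π * swap a b) = insert (π b) (excValues π) := by
  refine (excValues_mul_swap_subset π h.lt).antisymm fun y hy => ?_
  obtain ⟨i, rfl⟩ := π.surjective y
  rw [mem_excValues_mul_swap, symm_apply_apply]
  rw [Finset.mem_insert, apply_mem_excValues, π.injective.eq_iff] at hy
  by_cases hb : i = b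
  · rw [hb, swap_apply_right]; exact h.lt_apply
  · have hy := hy.resolve_left hb
    by_cases ha : i = a
    · subst ha; rw [swap_apply_left]; exact h.lt_of_lt hy
    · rwa [swap_apply_of_ne_of_ne ha hb]

theorem exists_lt_of_isSwap {t : Perm (Fin n)} (h : t.IsSwap) :
    ∃ a b : Fin n, a < b ∧ t = swap a b := by
  obtain ⟨a, b, hab, rfl⟩ := h
  rcases lt_or_gt_of_ne hab with h | h
  · exact ⟨a, b, h, rfl⟩
  · exact ⟨b, a, h, swap_comm _ _⟩

theorem swap_eq_swap_iff_of_lt {a b c d : Fin n} (h : a < b) (h' : c < d) :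
    swap a b = swap c d ↔ a = c ∧ b = d := by
  refine ⟨fun he => ?_, by rintro ⟨rfl, rfl⟩; rfl⟩
  have := swap_inj h.ne he
  rw [Sym2.eq_iff] at this
  omega

/-- Every letter of the word, applied after `π` and the preceding ones, creates an excedance. -/
def Steps : Perm (Fin n) → List (Perm (Fin n)) → Prop
  | _, [] => True
  | π, t :: l => (∃ a b, t = swap a b ∧ IsStep π a b) ∧ Steps (π * t) l

theorem steps_append {A B : List (Perm (Fin n))} {π : Perm (Fin n)} :
    Steps π (A ++ B) ↔ Steps π A ∧ Steps (π * A.prod) B := by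
  induction A generalizing π with
  | nil => simp [Steps]
  | cons t A ih => simp [Steps, ih, mul_assoc, and_assoc]

theorem Steps.isStep {A B : List (Perm (Fin n))} {π : Perm (Fin n)} {a b : Fin n}
    (h : Steps π (A ++ swap a b :: B)) (hab : a < b) : IsStep (π * A.prod) a b := by
  obtain ⟨c, d, he, hs⟩ := (steps_append.1 h).2.1
  obtain ⟨rfl, rfl⟩ := (swap_eq_swap_iff_of_lt hab hs.lt).1 he
  exact hs

theorem card_excValues_mul_prod_le {l : List (Perm (Fin n))} (hl : ∀ t ∈ l, t.IsSwap)
    (π : Perm (Fin n)) : (excValues (π * l.prod)).card ≤ (excValues π).card + l.length := by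
  induction l generalizing π with
  | nil => simp
  | cons t l ih =>
    obtain ⟨a, b, hab, rfl⟩ := exists_lt_of_isSwap (hl t (by simp))
    have h1 := ih (fun t ht => hl t (by simp [ht])) (π * swap a b)
    have h2 := card_excValues_mul_swap_le π hab
    rw [List.prod_cons, ← mul_assoc, List.length_cons]
    omega

/-- Each letter gains at most one value, so equality for the whole word forces equality at each
letter. -/
theorem steps_of_card {l : List (Perm (Fin n))} (hl : ∀ t ∈ l, t.IsSwap) {π : Perm (Fin n)}
    (hc : (excValues (π * l.prod)).card = (excValues π).card + l.length) : Steps π l := by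
  induction l generalizing π with
  | nil => trivial
  | cons t l ih =>
    have hl' : ∀ t ∈ l, t.IsSwap := fun t ht => hl t (by simp [ht])
    obtain ⟨a, b, hab, rfl⟩ := exists_lt_of_isSwap (hl t (by simp))
    have h1 := card_excValues_mul_prod_le hl' (π * swap a b)
    have h2 := card_excValues_mul_swap_le π hab
    rw [List.prod_cons, ← mul_assoc, List.length_cons] at hc
    exact ⟨⟨a, b, rfl, isStep_of_card hab (by omega)⟩, ih hl' (by omega)⟩

theorem Steps.card_excValues {l : List (Perm (Fin n))} {π : Perm (Fin n)} (h : Steps π l) :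
    (excValues (π * l.prod)).card = (excValues π).card + l.length := by
  induction l generalizing π with
  | nil => simp
  | cons t l ih =>
    obtain ⟨⟨a, b, rfl, hs⟩, h'⟩ := h
    rw [List.prod_cons, ← mul_assoc, ih h', hs.excValues_eq,
      Finset.card_insert_of_notMem hs.notMem, List.length_cons]
    ring

theorem Steps.isSwap {l : List (Perm (Fin n))} {π : Perm (Fin n)} (h : Steps π l) :
    ∀ t ∈ l, t.IsSwap := by
  induction l generalizing π with
  | nil => simp
  | cons t l ih =>
    obtain ⟨⟨a, b, rfl, hs⟩, h'⟩ := h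
    intro t ht
    rcases List.mem_cons.1 ht with rfl | ht
    · exact ⟨a, b, hs.lt.ne, rfl⟩
    · exact ih h' t ht

theorem excValues_one : excValues (1 : Perm (Fin n)) = ∅ := by
  ext y
  rw [mem_excValues]
  exact ⟨fun h => absurd h (lt_irrefl y), fun h => absurd h (Finset.notMem_empty y)⟩

theorem longCycle_apply {i : ℕ} (h : i + 1 < n) :
    longCycle n ⟨i, by omega⟩ = ⟨i + 1, h⟩ := by
  obtain ⟨m, rfl⟩ : ∃ m, n = m + 1 := ⟨n - 1, by omega⟩
  exact finRotate_of_lt (by omega)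

theorem excValues_subset (π : Perm (Fin n)) :
    excValues π ⊆ Finset.univ.filter fun y : Fin n => 0 < y.1 := by
  intro y hy
  rw [mem_excValues] at hy
  simp only [Finset.mem_filter, Finset.mem_univ, true_and]
  exact lt_of_le_of_lt (Nat.zero_le _) hy

theorem card_filter_pos : (Finset.univ.filter fun y : Fin n => 0 < y.1).card = n - 1 := by
  cases n with
  | zero => rfl
  | succ m =>
    have : (Finset.univ.filter fun y : Fin (m + 1) => 0 < y.1) = Finset.univ.erase 0 := by
      ext y
      simp only [Finset.mem_filter, Finset.mem_erase, Finset.mem_univ, true_and, and_true, Ne,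
        Fin.ext_iff, Fin.val_zero]
      omega
    rw [this, Finset.card_erase_of_mem (Finset.mem_univ _), Finset.card_fin]

theorem excValues_longCycle :
    excValues (longCycle n) = Finset.univ.filter fun y : Fin n => 0 < y.1 := by
  refine (excValues_subset _).antisymm fun y hy => ?_
  simp only [Finset.mem_filter, Finset.mem_univ, true_and] at hy
  have h := longCycle_apply (n := n) (i := y.1 - 1) (by omega)
  have h' : (⟨y.1 - 1 + 1, by omega⟩ : Fin n) = y := by ext; simp only; omega
  rw [h'] at h
  rw [← h, apply_mem_excValues, h, Fin.lt_def]
  simp only; omega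

/-- All positive values are excedances, so the preimage of `i + 1` is at most `i`; the positions
below `i` are already the preimages of `1, …, i`, which leaves `i`. -/
theorem eq_longCycle_of_card {π : Perm (Fin n)} (h : (excValues π).card = n - 1) :
    π = longCycle n := by
  have hE : excValues π = Finset.univ.filter fun y : Fin n => 0 < y.1 :=
    Finset.eq_of_subset_of_card_le (excValues_subset π) (by rw [card_filter_pos, h])
  have key : ∀ i (hi : i + 1 < n), π.symm ⟨i + 1, hi⟩ = ⟨i, by omega⟩ := by
    intro i
    induction i using Nat.strong_induction_on with
    | _ i ih =>
      intro hi
      have h1 : (⟨i + 1, hi⟩ : Fin n) ∈ excValues π := by rw [hE]; simp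
      rw [mem_excValues] at h1
      by_contra hne
      obtain ⟨j, hj⟩ : ∃ j, j = π.symm ⟨i + 1, hi⟩ := ⟨_, rfl⟩
      rw [← hj] at h1 hne
      rw [Fin.lt_def] at h1
      rw [Fin.ext_iff] at hne
      simp only at h1 hne
      have h2 := ih j.1 (by omega) (by omega)
      have := congrArg Fin.val (π.symm.injective (h2.trans hj))
      simp only at this
      omega
  -- The quotient can move only the last point, and no permutation moves exactly one point.
  have hfix : (π⁻¹ * longCycle n).support.card ≤ 1 := by
    rw [Finset.card_le_one]
    have : ∀ i ∈ (π⁻¹ * longCycle n).support, i.1 + 1 = n := by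
      intro i hi
      rw [Perm.mem_support] at hi
      by_contra hne
      apply hi
      rw [Perm.mul_apply, show longCycle n i = _ from longCycle_apply (n := n) (i := i.1) (by omega)]
      exact key i.1 (by omega)
    intro i hi j hj
    have h1 := this i hi
    have h2 := this j hj
    omega
  exact inv_mul_eq_one.1 (Perm.card_support_le_one.1 hfix)

theorem F.steps (v : F n) : Steps 1 v.word := by
  refine steps_of_card v.isSwap ?_
  rw [one_mul, v.prod_word, excValues_longCycle, card_filter_pos, excValues_one, v.length_word]
  simp

/-- A word of `n - 1` transpositions each of which creates an excedance is an element of `F n`. -/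
def ofSteps (l : List (Perm (Fin n))) (hl : l.length = n - 1) (h : Steps 1 l) : F n where
  word := l
  length_word := hl
  isSwap := h.isSwap
  prod_word := eq_longCycle_of_card (by
    have := h.card_excValues
    rwa [one_mul, excValues_one, Finset.card_empty, zero_add, hl] at this)

/-- An excedance position stays one, and its image never grows: `b` is not such a position, and at
`a` the image drops from `π a > b` to `π b`, which lies in `(a, b]`. -/
theorem IsStep.persist {π : Perm (Fin n)} {a b i m : Fin n} (h : IsStep π a b) (h1 : i < π i)
    (h2 : π i ≤ m) : i < (π * swap a b) i ∧ (π * swap a b) i ≤ m := by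
  rw [Perm.mul_apply]
  by_cases ha : i = a
  · subst ha
    rw [swap_apply_left]
    exact ⟨h.lt_apply, h.apply_le.trans ((h.lt_of_lt h1).le.trans h2)⟩
  · by_cases hb : i = b
    · subst hb; exact absurd h1 (not_lt.2 h.apply_le)
    · rw [swap_apply_of_ne_of_ne ha hb]; exact ⟨h1, h2⟩

theorem Steps.persist {l : List (Perm (Fin n))} {π : Perm (Fin n)} (h : Steps π l) {i m : Fin n}
    (h1 : i < π i) (h2 : π i ≤ m) : i < (π * l.prod) i ∧ (π * l.prod) i ≤ m := by
  induction l generalizing π with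
  | nil => simpa using ⟨h1, h2⟩
  | cons t l ih =>
    obtain ⟨⟨a, b, rfl, hs⟩, h'⟩ := h
    rw [List.prod_cons, ← mul_assoc]
    obtain ⟨h3, h4⟩ := hs.persist h1 h2
    exact ih h' h3 h4

/-- After a letter `(a b)`, the image of `a` stays in `(a, b]`. -/
theorem Steps.persist_swap {A B : List (Perm (Fin n))} {π : Perm (Fin n)} {a b : Fin n}
    (hab : a < b) (h : Steps π (A ++ swap a b :: B)) :
    a < (π * (A ++ swap a b :: B).prod) a ∧ (π * (A ++ swap a b :: B).prod) a ≤ b := by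
  have hs := h.isStep hab
  have h3 := (steps_append.1 h).2.2
  have := h3.persist (i := a) (m := b) (by simpa using hs.lt_apply) (by simpa using hs.apply_le)
  simpa [mul_assoc] using this

end Excedances

/-! ### Inversions of lists of numbers -/

section Inversions

/-- The number of inversions of a list. -/
def inversions : List ℕ → ℕ
  | [] => 0
  | x :: l => l.countP (fun y => decide (y < x)) + inversions l

theorem inversions_append_swap {x y : ℕ} (h : x < y) (A B : List ℕ) :
    inversions (A ++ y :: x :: B) = inversions (A ++ x :: y :: B) + 1 := by
  induction A with
  | nil =>
    simp only [List.nil_append, inversions, List.countP_cons, decide_eq_true_eq, h, if_true,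
      not_lt.2 h.le, if_false]
    ring
  | cons z A ih =>
    simp only [List.cons_append, inversions, ih, List.countP_append, List.countP_cons]
    ring

theorem inversions_le_of_pairwise_gt {l l' : List ℕ} (hl : l.length = l'.length)
    (h : l'.Pairwise (· > ·)) : inversions l ≤ inversions l' := by
  induction l generalizing l' with
  | nil => exact Nat.zero_le _
  | cons x l ih =>
    cases l' with
    | nil => simp at hl
    | cons y l' =>
      rw [List.pairwise_cons] at h
      have h1 : l'.countP (fun z => decide (z < y)) = l'.length := by
        rw [List.countP_eq_length]; intro z hz; simpa using h.1 z hz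
      have h2 := List.countP_le_length (p := fun z => decide (z < x)) (l := l)
      have h3 := ih (by simpa using hl) h.2
      simp only [List.length_cons] at hl
      simp only [inversions, h1]
      omega

/-- By transitivity, a failure of sortedness already shows at two neighboring entries. -/
theorem exists_consecutive_not {R : ℕ → ℕ → Prop} [IsTrans ℕ R] {l : List ℕ}
    (h : ¬ l.Pairwise R) : ∃ A x y B, l = A ++ x :: y :: B ∧ ¬ R x y := by
  rw [← List.isChain_iff_pairwise] at h
  induction l with
  | nil => simp at h
  | cons x l ih =>
    cases l with
    | nil => simp at h
    | cons y l =>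
      by_cases hxy : R x y
      · rw [List.isChain_cons_cons] at h
        obtain ⟨A, x', y', B, he, hR⟩ := ih fun h' => h ⟨hxy, h'⟩
        exact ⟨x :: A, x', y', B, by rw [he]; rfl, hR⟩
      · exact ⟨[], x, y, l, rfl, hxy⟩

end Inversions

/-! ### Labels of a factorization -/

section Labels
variable {n : ℕ}

/-- The label of a transposition `(a b)`, `a < b`, that is multiplied to `π`: it is `π b`. -/
def label (π t : Perm (Fin n)) : ℕ := ∑ i, if t i < i then (π i : ℕ) else 0

/-- The larger entry `b` is the only point that the transposition moves down, so the sum has one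
term; the sum spares a choice of `a` and `b`. -/
theorem label_swap (π : Perm (Fin n)) {a b : Fin n} (h : a < b) : label π (swap a b) = π b := by
  unfold label
  rw [Finset.sum_eq_single b]
  · rw [swap_apply_right, if_pos h]
  · intro i _ hb
    by_cases ha : i = a
    · rw [ha, swap_apply_left, if_neg h.not_gt]
    · rw [swap_apply_of_ne_of_ne ha hb, if_neg (lt_irrefl _)]
  · simp

/-- The labels of the letters of a word that is multiplied to `π`. -/
def labels : Perm (Fin n) → List (Perm (Fin n)) → List ℕ
  | _, [] => []
  | π, t :: l => label π t :: labels (π * t) l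

theorem labels_append (π : Perm (Fin n)) (A B : List (Perm (Fin n))) :
    labels π (A ++ B) = labels π A ++ labels (π * A.prod) B := by
  induction A generalizing π with
  | nil => simp [labels]
  | cons t A ih => simp [labels, ih, mul_assoc]

theorem length_labels (π : Perm (Fin n)) (l : List (Perm (Fin n))) :
    (labels π l).length = l.length := by
  induction l generalizing π with
  | nil => rfl
  | cons t l ih => simp [labels, ih]

theorem Steps.excValues_subset {l : List (Perm (Fin n))} {π : Perm (Fin n)} (h : Steps π l) :
    excValues π ⊆ excValues (π * l.prod) := by
  induction l generalizing π with
  | nil => simp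
  | cons t l ih =>
    obtain ⟨⟨a, b, rfl, hs⟩, h'⟩ := h
    have := ih h'
    rw [hs.excValues_eq, mul_assoc, ← List.prod_cons] at this
    exact (Finset.subset_insert _ _).trans this

theorem Steps.mem_labels {l : List (Perm (Fin n))} {π : Perm (Fin n)} (h : Steps π l) {x : ℕ}
    (hx : x ∈ labels π l) : ∃ y : Fin n, y.1 = x ∧ y ∉ excValues π ∧ 0 < x := by
  induction l generalizing π with
  | nil => simp [labels] at hx
  | cons t l ih =>
    obtain ⟨⟨a, b, rfl, hs⟩, h'⟩ := h
    rw [labels, List.mem_cons] at hx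
    rcases hx with rfl | hx
    · rw [label_swap π hs.lt]
      exact ⟨_, rfl, hs.notMem, lt_of_le_of_lt (Nat.zero_le _) hs.lt_apply⟩
    · obtain ⟨y, h1, h2, h3⟩ := ih h' hx
      rw [hs.excValues_eq, Finset.mem_insert, not_or] at h2
      exact ⟨y, h1, h2.2, h3⟩

/-- A label is an excedance value from its letter on, while every later label is not yet one when
its letter comes. -/
theorem Steps.nodup_labels {l : List (Perm (Fin n))} {π : Perm (Fin n)} (h : Steps π l) :
    (labels π l).Nodup := by
  induction l generalizing π with
  | nil => exact List.nodup_nil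
  | cons t l ih =>
    obtain ⟨⟨a, b, rfl, hs⟩, h'⟩ := h
    rw [labels, List.nodup_cons]
    refine ⟨fun hm => ?_, ih h'⟩
    obtain ⟨y, h1, h2, -⟩ := h'.mem_labels hm
    rw [label_swap π hs.lt, Fin.val_inj] at h1
    rw [hs.excValues_eq, h1] at h2
    exact h2 (Finset.mem_insert_self _ _)

/-- The labels of a factorization of the long cycle. -/
def F.labels (v : F n) : List ℕ := HurwitzWeak.labels 1 v.word

theorem F.length_labels (v : F n) : v.labels.length = n - 1 := by
  rw [F.labels, HurwitzWeak.length_labels, v.length_word]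

/-- These are `n - 1` distinct values among `1, …, n - 1`; the value `0` is never an excedance. -/
theorem F.labels_perm (v : F n) : v.labels.Perm (List.range' 1 (n - 1)) := by
  refine List.Subperm.perm_of_length_le
    (List.subperm_of_subset v.steps.nodup_labels fun x hx => ?_) (by simp [v.length_labels])
  obtain ⟨y, rfl, -, h⟩ := v.steps.mem_labels hx
  rw [List.mem_range'_1]
  have := y.2
  omega

theorem F.labels_of_pairwise_lt {v : F n} (h : v.labels.Pairwise (· < ·)) :
    v.labels = List.range' 1 (n - 1) :=
  v.labels_perm.eq_of_pairwise (fun a b _ _ h1 h2 => absurd h1 h2.not_gt) h List.pairwise_lt_range'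

theorem F.labels_of_pairwise_gt {v : F n} (h : v.labels.Pairwise (· > ·)) :
    v.labels = (List.range' 1 (n - 1)).reverse := by
  refine (v.labels_perm.trans (List.reverse_perm _).symm).eq_of_pairwise
    (fun a b _ _ h1 h2 => absurd h1 h2.not_gt) h ?_
  rw [List.pairwise_reverse]
  exact List.pairwise_lt_range'

end Labels

/-! ### Edges of the Hurwitz graph and exchanges of labels -/

section Adjacency
variable {n : ℕ}

theorem F.getElem_word_eq {u v : F n} {i : ℕ} (hu : i < u.word.length) (hv : i < v.word.length)
    (h1 : u.chainElt i = v.chainElt i) (h2 : u.chainElt (i + 1) = v.chainElt (i + 1)) :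
    u.word[i] = v.word[i] := by
  rw [u.chainElt_succ hu, v.chainElt_succ hv, h1] at h2
  exact mul_left_cancel h2

/-- A letter is the quotient of two consecutive chain elements, so changing one element affects only
the two letters around it. The ends `1` and `c` are common to all chains. -/
theorem exists_of_adj {u v : F n} (h : (hurwitzGraph n).Adj u v) :
    ∃ A B t s t' s', u.word = A ++ t :: s :: B ∧ v.word = A ++ t' :: s' :: B ∧
      t * s = t' * s' := by
  obtain ⟨k, hk, huq⟩ := h
  have heq : ∀ m, m ≠ k → u.chainElt m = v.chainElt m := fun m hm => by
    by_contra hne; exact hm (huq m hne)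
  have hk0 : k ≠ 0 := by rintro rfl; exact hk (by simp [F.chainElt_zero])
  have hkn : k < n - 1 := by
    by_contra hle
    exact hk (by rw [u.chainElt_of_ge (by omega), v.chainElt_of_ge (by omega)])
  obtain ⟨j, rfl⟩ : ∃ j, k = j + 1 := ⟨k - 1, by omega⟩
  have lu := u.length_word
  have lv := v.length_word
  have dec : ∀ w : List (Perm (Fin n)), (hw : w.length = n - 1) →
      w = w.take j ++ w[j]'(by omega) :: w[j + 1]'(by omega) :: w.drop (j + 2) := by
    intro w hw
    rw [List.cons_getElem_drop_succ, List.cons_getElem_drop_succ, List.take_append_drop]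
  have ht : u.word.take j = v.word.take j := by
    refine List.ext_getElem (by simp [lu, lv]) fun i h1 h2 => ?_
    rw [List.length_take] at h1
    rw [List.getElem_take, List.getElem_take]
    exact F.getElem_word_eq _ _ (heq _ (by omega)) (heq _ (by omega))
  have hd : u.word.drop (j + 2) = v.word.drop (j + 2) := by
    refine List.ext_getElem (by simp [lu, lv]) fun i h1 h2 => ?_
    rw [List.length_drop] at h1 h2
    rw [List.getElem_drop, List.getElem_drop]
    exact F.getElem_word_eq _ _ (heq _ (by omega)) (heq _ (by omega))
  refine ⟨_, _, _, _, _, _, dec u.word lu, by rw [ht, hd]; exact dec v.word lv, ?_⟩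
  have h1 := heq (j + 2) (by omega)
  rw [u.chainElt_succ (by omega), v.chainElt_succ (by omega), u.chainElt_succ (by omega),
    v.chainElt_succ (by omega), heq j (by omega), mul_assoc, mul_assoc] at h1
  exact mul_left_cancel h1

theorem adj_of_words {u v : F n} {A B : List (Perm (Fin n))} {t s t' s' : Perm (Fin n)}
    (hu : u.word = A ++ t :: s :: B) (hv : v.word = A ++ t' :: s' :: B)
    (h : t * s = t' * s') (hne : t ≠ t') : (hurwitzGraph n).Adj u v := by
  refine ⟨A.length + 1, ?_, fun k hk => ?_⟩
  · simp only [F.chainElt, hu, hv]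
    rw [List.take_length_add_append, List.take_length_add_append]
    simpa using hne
  · by_contra hne'
    apply hk
    simp only [F.chainElt, hu, hv]
    rcases Nat.lt_or_gt_of_ne hne' with hlt | hlt
    · rw [List.take_append_of_le_length (by omega), List.take_append_of_le_length (by omega)]
    · obtain ⟨j, rfl⟩ : ∃ j, k = A.length + (j + 2) := ⟨k - A.length - 2, by omega⟩
      rw [List.take_length_add_append, List.take_length_add_append]
      simp only [List.take_succ_cons, List.prod_append, List.prod_cons]
      rw [← mul_assoc t, ← mul_assoc t', h]

theorem labels_of_words {A B : List (Perm (Fin n))} {t s : Perm (Fin n)} (π : Perm (Fin n)) :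
    labels π (A ++ t :: s :: B) = labels π A ++ label (π * A.prod) t ::
      label (π * A.prod * t) s :: labels (π * A.prod * (t * s)) B := by
  simp [labels_append, labels, mul_assoc]

/-- Adjacent chains have labels that differ at most by the exchange of two consecutive ones. -/
theorem labels_of_adj {u v : F n} (h : (hurwitzGraph n).Adj u v) :
    ∃ A x y B, u.labels = A ++ x :: y :: B ∧
      (v.labels = A ++ x :: y :: B ∨ v.labels = A ++ y :: x :: B) := by
  obtain ⟨A, B, t, s, t', s', hu, hv, he⟩ := exists_of_adj h
  -- Both lists permute the same numbers and agree away from two positions, so the two pairs there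
  -- agree up to order.
  have hp := u.labels_perm.trans v.labels_perm.symm
  simp only [F.labels, hu, hv, labels_of_words, ← he] at hp ⊢
  refine ⟨_, _, _, _, rfl, ?_⟩
  rw [List.perm_append_left_iff] at hp
  generalize label (1 * A.prod) t = x at *
  generalize label (1 * A.prod * t) s = y at *
  generalize label (1 * A.prod) t' = x' at *
  generalize label (1 * A.prod * t') s' = y' at *
  generalize labels (1 * A.prod * (t * s)) B = L at *
  have hp' : ([x, y] ++ L).Perm ([x', y'] ++ L) := hp
  rw [List.perm_append_right_iff, List.pair_perm] at hp'
  simp only [List.cons.injEq, and_true] at hp'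
  rcases hp' with ⟨rfl, rfl⟩ | ⟨rfl, rfl⟩
  · exact Or.inl rfl
  · exact Or.inr rfl

theorem inversions_le_of_adj {u v : F n} (h : (hurwitzGraph n).Adj u v) :
    inversions v.labels ≤ inversions u.labels + 1 := by
  obtain ⟨A, x, y, B, hu, hv | hv⟩ := labels_of_adj h
  · rw [hu, hv]; omega
  · rw [hu, hv]
    rcases lt_trichotomy x y with h | rfl | h
    · rw [inversions_append_swap h]
    · omega
    · rw [inversions_append_swap h]; omega

/-- Two consecutive letters can be replaced by two others with the same product and with the two
labels exchanged. If the labels increase, the letters commute or have the form `(a b)`, `(b d)`. -/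
theorem exists_exchange {π : Perm (Fin n)} {a b c d : Fin n} (h1 : IsStep π a b)
    (h2 : IsStep (π * swap a b) c d) :
    ∃ t s : Perm (Fin n), t.IsSwap ∧ s.IsSwap ∧ t * s = swap a b * swap c d ∧
      label π t = label (π * swap a b) (swap c d) ∧
      label (π * t) s = label π (swap a b) ∧
      (label π (swap a b) < label (π * swap a b) (swap c d) →
        b = c ∨ (t = swap c d ∧ s = swap a b)) := by
  have hab := h1.lt
  have hcd := h2.lt
  rw [label_swap _ hab, label_swap _ hcd]
  have g1 := h1.lt_apply
  have g2 := h1.apply_le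
  have g3 := h1.lt_of_lt
  have g4 := h2.lt_apply
  have g5 := h2.apply_le
  have g6 := h2.lt_of_lt
  simp only [Perm.mul_apply] at g4 g5 g6 ⊢
  -- Here `(a b)(b d) = (b d)(a d)`. This is the only non-commuting case in which the labels can
  -- increase.
  by_cases hbc : b = c
  · subst hbc
    have had := hab.trans hcd
    refine ⟨swap b d, swap a d, ⟨_, _, hcd.ne, rfl⟩, ⟨_, _, had.ne, rfl⟩, ?_, ?_, ?_, fun _ =>
      Or.inl rfl⟩
    · rw [mul_swap_eq_swap_mul (swap b d), swap_apply_right,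
        swap_apply_of_ne_of_ne hab.ne had.ne]
    · rw [label_swap _ hcd, swap_apply_of_ne_of_ne had.ne' hcd.ne']
    · rw [label_swap _ had, Perm.mul_apply, swap_apply_right]
  by_cases hda : d = a
  · subst hda
    rw [swap_apply_left] at g4 g5
    omega
  -- Common smaller entry: `(a b)(a d) = (a d)(d b)`. The second step forces `d < π b ≤ b`, and `π d
  -- ≤ d`, so the labels decrease.
  by_cases hac : a = c
  · subst hac
    by_cases hbd : b = d
    · subst hbd; rw [swap_apply_right] at g4 g5; rw [swap_apply_left] at g6; omega
    · rw [swap_apply_of_ne_of_ne hda (Ne.symm hbd)] at g4 g5 ⊢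
      rw [swap_apply_left] at g6
      have hdb : d < b := by omega
      refine ⟨swap a d, swap d b, ⟨_, _, hcd.ne, rfl⟩, ⟨_, _, hdb.ne, rfl⟩, ?_, ?_, ?_, fun h => ?_⟩
      · rw [mul_swap_eq_swap_mul (swap a d), swap_apply_right,
          swap_apply_of_ne_of_ne hab.ne' hdb.ne']
      · rw [label_swap _ hcd]
      · rw [label_swap _ hdb, Perm.mul_apply, swap_apply_of_ne_of_ne hab.ne' hdb.ne']
      · omega
  -- Common larger entry: `(a b)(c b) = (c a)(a b)`. The steps give `c < π a ≤ a < π b`, so the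
  -- labels decrease.
  by_cases hbd : b = d
  · subst hbd
    rw [swap_apply_right] at g4 g5 ⊢
    rw [swap_apply_of_ne_of_ne (Ne.symm hac) (Ne.symm hbc)] at g6
    have hca : c < a := by omega
    refine ⟨swap c a, swap a b, ⟨_, _, hca.ne, rfl⟩, ⟨_, _, hab.ne, rfl⟩, ?_, ?_, ?_, fun h => ?_⟩
    · rw [mul_swap_eq_swap_mul (swap a b), swap_apply_right,
        swap_apply_of_ne_of_ne hca.ne hcd.ne]
    · rw [label_swap _ hca]
    · rw [label_swap _ hab, Perm.mul_apply, swap_apply_of_ne_of_ne hcd.ne' hab.ne']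
    · omega
  · refine ⟨swap c d, swap a b, ⟨_, _, hcd.ne, rfl⟩, ⟨_, _, hab.ne, rfl⟩, ?_, ?_, ?_, fun _ =>
      Or.inr ⟨rfl, rfl⟩⟩
    · rw [mul_swap_eq_swap_mul (swap a b), swap_apply_of_ne_of_ne (Ne.symm hac) (Ne.symm hbc),
        swap_apply_of_ne_of_ne hda (Ne.symm hbd)]
    · rw [label_swap _ hcd, swap_apply_of_ne_of_ne hda (Ne.symm hbd)]
    · rw [label_swap _ hab, Perm.mul_apply, swap_apply_of_ne_of_ne hbc hbd]

end Adjacency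

/-! ### Distance from the base point and maximal elements -/

section Distance
variable {n : ℕ}

theorem F.ne_of_labels_eq {v : F n} {L M : List ℕ} {x y : ℕ} (h : v.labels = L ++ x :: y :: M) :
    x ≠ y := by
  rintro rfl
  have := v.steps.nodup_labels
  rw [← F.labels, h, List.nodup_append] at this
  simp at this

/-- Since the new pair of letters has the old product, the labels after it are unchanged. The last
clause serves surjectivity: at an ascent, either some vertex has both a smaller and a larger
neighbor, or the letters are merely permuted. -/
theorem exists_adj_exchange (v : F n) {L M : List ℕ} {x y : ℕ}
    (h : v.labels = L ++ x :: y :: M) :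
    ∃ u : F n, (hurwitzGraph n).Adj v u ∧ u.labels = L ++ y :: x :: M ∧
      (x < y → (∃ a b d, a < b ∧ b < d ∧ swap a b ∈ v.word ∧ swap b d ∈ v.word) ∨
        u.word.Perm v.word) := by
  have hlen := v.length_labels
  rw [h] at hlen
  simp only [List.length_append, List.length_cons] at hlen
  have hwl := v.length_word
  have hw : v.word = v.word.take L.length ++ v.word[L.length] :: v.word[L.length + 1] ::
      v.word.drop (L.length + 2) := by
    rw [List.cons_getElem_drop_succ, List.cons_getElem_drop_succ, List.take_append_drop]
  have hAl : (v.word.take L.length).length = L.length := by rw [List.length_take]; omega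
  generalize v.word.take L.length = A at hw hAl
  generalize v.word.drop (L.length + 2) = B at hw
  generalize v.word[L.length] = t at hw
  generalize v.word[L.length + 1] = s at hw
  have hst := v.steps
  rw [hw, steps_append] at hst
  obtain ⟨-, ⟨a, b, rfl, h1⟩, ⟨c, d, rfl, h2⟩, -⟩ := hst
  obtain ⟨t', s', ht', hs', he, hl1, hl2, hor⟩ := exists_exchange h1 h2
  have hlab : labels 1 A ++ label (1 * A.prod) (swap a b) ::
      label (1 * A.prod * swap a b) (swap c d) ::
      labels (1 * A.prod * (swap a b * swap c d)) B = L ++ x :: y :: M := by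
    rw [← h, F.labels, hw, labels_of_words]
  obtain ⟨hL, hrest⟩ := List.append_inj hlab (by rw [length_labels, hAl])
  simp only [List.cons.injEq] at hrest
  obtain ⟨hx, hy, hM⟩ := hrest
  let u : F n :=
    { word := A ++ t' :: s' :: B
      length_word := by rw [← hwl, hw]; simp
      isSwap := by
        intro r hr
        simp only [List.mem_append, List.mem_cons] at hr
        rcases hr with hr | rfl | rfl | hr
        · exact v.isSwap r (by rw [hw]; simp [hr])
        · exact ht'
        · exact hs'
        · exact v.isSwap r (by rw [hw]; simp [hr])
      prod_word := by
        rw [← v.prod_word, hw]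
        simp only [List.prod_append, List.prod_cons]
        rw [← mul_assoc t', he, mul_assoc (swap a b)] }
  have hul : u.labels = L ++ y :: x :: M := by
    change labels 1 (A ++ t' :: s' :: B) = _
    rw [labels_of_words, hl1, hl2, he, hL, hx, hy, hM]
  refine ⟨u, adj_of_words hw (show u.word = A ++ t' :: s' :: B from rfl) he.symm ?_, hul,
    fun hxy => ?_⟩
  · rintro rfl
    rw [hx, hy] at hl1
    exact F.ne_of_labels_eq h hl1
  · rw [hx, hy] at hor
    rcases hor hxy with rfl | ⟨rfl, rfl⟩
    · exact Or.inl ⟨a, b, d, h1.lt, h2.lt, by rw [hw]; simp, by rw [hw]; simp⟩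
    · right
      change (A ++ _).Perm _
      rw [hw]
      exact List.Perm.append_left _ (List.Perm.swap _ _ _)

theorem word_of_labels_eq_range' {l : List (Perm (Fin n))} (h : Steps 1 l)
    (hl : labels 1 l = List.range' 1 l.length) :
    (∀ i (hi : i < l.length), ∃ h' : i + 1 < n,
      l[i] = swap ⟨i, by omega⟩ ⟨i + 1, h'⟩ ∧ (l.prod ⟨i, by omega⟩).1 = i + 1) ∧
    ∀ j : Fin n, l.length < j.1 → l.prod j = j := by
  induction l using List.reverseRecOn with
  | nil => simp
  | append_singleton m t ih =>
    obtain ⟨hm, ⟨a, b, rfl, hs⟩, -⟩ := steps_append.1 h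
    rw [one_mul] at hs
    rw [labels_append, List.length_append, List.length_singleton, ← List.range'_append] at hl
    obtain ⟨hl1, hl2⟩ := List.append_inj hl (by simp [length_labels])
    simp only [one_mul, labels, label_swap _ hs.lt, List.range'_one, List.cons.injEq,
      and_true] at hl2
    obtain ⟨ih1, ih2⟩ := ih hm hl1
    -- The label `m.length + 1` is a point fixed by the prefix, so its preimage `b` is that point
    -- itself.
    have hb : b.1 = m.length + 1 := by
      have hn := (m.prod b).2
      have h1 := ih2 (m.prod b) (by omega)
      have h2 := m.prod.injective h1
      rw [← hl2.trans (Nat.add_comm _ _), ← h2, h2, h2]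
    -- For a smaller `a` the prefix sends `a` to `a + 1`, and a step would require `b < a + 1`.
    have ha : a.1 = m.length := by
      have hab : a.1 < b.1 := hs.lt
      by_contra hne
      obtain ⟨h1, -, h2⟩ := ih1 a.1 (by omega)
      rw [Fin.eta] at h2
      have := hs.lt_of_lt (by rw [Fin.lt_def]; omega)
      rw [Fin.lt_def] at this
      omega
    have hbn := b.2
    have ha' : a = ⟨m.length, by omega⟩ := Fin.ext ha
    have hb' : b = ⟨m.length + 1, by omega⟩ := Fin.ext hb
    refine ⟨fun i hi => ?_, fun j hj => ?_⟩
    · simp only [List.length_append, List.length_singleton] at hi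
      refine ⟨by omega, ?_⟩
      rw [List.prod_append, List.prod_singleton, Perm.mul_apply]
      rcases Nat.lt_or_ge i m.length with hlt | hge
      · obtain ⟨h1, h2, h3⟩ := ih1 i hlt
        rw [List.getElem_append_left hlt, swap_apply_of_ne_of_ne]
        · exact ⟨h2, h3⟩
        · rw [Ne, Fin.ext_iff]; simp only; omega
        · rw [Ne, Fin.ext_iff]; simp only; omega
      · obtain rfl : i = m.length := by omega
        rw [List.getElem_concat_length rfl, ← ha', ← hb', swap_apply_left]
        exact ⟨rfl, by omega⟩
    · simp only [List.length_append, List.length_singleton] at hj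
      rw [List.prod_append, List.prod_singleton, Perm.mul_apply, swap_apply_of_ne_of_ne]
      · exact ih2 j (by omega)
      · rw [Ne, Fin.ext_iff]; omega
      · rw [Ne, Fin.ext_iff]; omega

theorem eq_e_of_pairwise {v : F n} (h : v.labels.Pairwise (· < ·)) : v = e n := by
  have hv := F.labels_of_pairwise_lt h
  rw [← v.length_word] at hv
  obtain ⟨h1, -⟩ := word_of_labels_eq_range' v.steps hv
  ext1
  refine List.ext_getElem (by rw [v.length_word, (e n).length_word]) fun i hi hi' => ?_
  obtain ⟨h2, h3, -⟩ := h1 i hi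
  rw [h3]
  simp [e, idWord]

theorem inversions_of_pairwise_lt {l : List ℕ} (h : l.Pairwise (· < ·)) : inversions l = 0 := by
  induction l with
  | nil => rfl
  | cons x l ih =>
    rw [List.pairwise_cons] at h
    rw [inversions, ih h.2, add_zero, List.countP_eq_zero]
    intro y hy
    simpa using (h.1 y hy).le

/-- Exchanging the labels at a descent is an edge that removes one inversion; with no descent left,
the chain is `e`. -/
theorem exists_walk_length_eq (v : F n) :
    ∃ p : (hurwitzGraph n).Walk (e n) v, p.length = inversions v.labels := by
  induction hk : inversions v.labels generalizing v with
  | zero =>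
    by_cases h : v.labels.Pairwise (· < ·)
    · obtain rfl := eq_e_of_pairwise h
      exact ⟨.nil, rfl⟩
    · exfalso
      obtain ⟨A, x, y, B, he, hxy⟩ := exists_consecutive_not h
      have hne := F.ne_of_labels_eq he
      rw [he, inversions_append_swap (by omega)] at hk
      omega
  | succ k ih =>
    have h : ¬ v.labels.Pairwise (· < ·) := fun h => by
      rw [inversions_of_pairwise_lt h] at hk; omega
    obtain ⟨A, x, y, B, he, hxy⟩ := exists_consecutive_not h
    have hne := F.ne_of_labels_eq he
    obtain ⟨u, hu, hul, -⟩ := exists_adj_exchange v he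
    rw [he, inversions_append_swap (by omega), ← hul] at hk
    obtain ⟨p, hp⟩ := ih u (by omega)
    exact ⟨p.concat hu.symm, by rw [SimpleGraph.Walk.length_concat, hp]⟩

theorem inversions_le_add_length {u v : F n} (p : (hurwitzGraph n).Walk u v) :
    inversions v.labels ≤ inversions u.labels + p.length := by
  induction p with
  | nil => simp
  | cons h p ih =>
    have := inversions_le_of_adj h
    rw [SimpleGraph.Walk.length_cons]
    omega

theorem exists_pairwise_labels (v : F n) : ∃ u : F n, u.labels.Pairwise (· < ·) := by
  induction hk : inversions v.labels using Nat.strong_induction_on generalizing v with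
  | _ k ih =>
    by_cases h : v.labels.Pairwise (· < ·)
    · exact ⟨v, h⟩
    · obtain ⟨A, x, y, B, he, hxy⟩ := exists_consecutive_not h
      have hne := F.ne_of_labels_eq he
      obtain ⟨u, hu, hul, -⟩ := exists_adj_exchange v he
      rw [he, inversions_append_swap (by omega), ← hul] at hk
      exact ih _ (by omega) u rfl

/-- No labels are computed: sorting any chain ends at one with increasing labels, and that chain
must be `e`. -/
theorem inversions_labels_e : inversions (e n).labels = 0 := by
  obtain ⟨u, hu⟩ := exists_pairwise_labels (e n)
  rw [← eq_e_of_pairwise hu, inversions_of_pairwise_lt hu]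

/-- The distance from the base point in the Hurwitz graph is the number of inversions of the
labels. -/
theorem dist_e_eq (v : F n) : (hurwitzGraph n).dist (e n) v = inversions v.labels := by
  obtain ⟨p, hp⟩ := exists_walk_length_eq v
  refine le_antisymm (hp ▸ SimpleGraph.dist_le p) ?_
  obtain ⟨q, hq⟩ := p.reachable.exists_walk_length_eq_dist
  rw [← hq]
  simpa [inversions_labels_e] using inversions_le_add_length q

/-- The maximal elements of the weak order are the chains with decreasing labels. -/
theorem isWeakMax_iff {v : F n} : IsWeakMax v ↔ v.labels.Pairwise (· > ·) := by
  classical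
  constructor
  -- Exchanging an ascent adds an inversion, so this edge extends a geodesic from `e` beyond `v`.
  · intro h
    by_contra hnot
    obtain ⟨A, x, y, B, he, hxy⟩ := exists_consecutive_not hnot
    have hne := F.ne_of_labels_eq he
    obtain ⟨u, hu, hul, -⟩ := exists_adj_exchange v he
    obtain ⟨p, hp⟩ := exists_walk_length_eq v
    refine hu.ne (h u ⟨p.concat hu, ?_, ?_⟩).symm
    · rw [SimpleGraph.Walk.length_concat, hp, dist_e_eq, hul, inversions_append_swap (by omega), he]
    · rw [SimpleGraph.Walk.support_concat]
      simp
  -- Decreasing labels have the most inversions, so nothing is left of the geodesic after it has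
  -- reached `v`.
  · rintro h u ⟨p, hp, hv⟩
    rw [dist_e_eq] at hp
    have h1 := inversions_le_of_pairwise_gt (l := u.labels) (l' := v.labels)
      (by rw [u.length_labels, v.length_labels]) h
    have h2 := congrArg SimpleGraph.Walk.length (p.take_spec hv)
    rw [SimpleGraph.Walk.length_append] at h2
    have h3 := inversions_le_add_length (p.takeUntil v hv)
    rw [inversions_labels_e] at h3
    exact (SimpleGraph.Walk.eq_of_length_eq_zero (p := p.dropUntil v hv) (by omega)).symm

end Distance

/-! ### Non-crossing trees from factorizations -/

section Graph
variable {n : ℕ}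

theorem card_edgeSet_listGraph_le (l : List (Perm (Fin n))) :
    Nat.card (listGraph l).edgeSet ≤ l.length := by
  classical
  rw [Nat.card_coe_set_eq]
  refine le_trans ?_ (List.toFinset_card_le l)
  rw [← Set.ncard_coe_finset]
  refine Set.ncard_le_ncard_of_injOn
    (fun s => Sym2.lift ⟨fun a b => swap a b, fun a b => swap_comm a b⟩ s) ?_ ?_
  · intro s
    induction s using Sym2.ind with
    | _ a b => intro h; simpa using h.2
  · intro s hs s' hs'
    induction s using Sym2.ind with
    | _ a b =>
      induction s' using Sym2.ind with
      | _ c d => intro h; exact swap_inj hs.1 h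

theorem card_le_of_connected_listGraph {l : List (Perm (Fin n))} (h : (listGraph l).Connected) :
    n ≤ l.length + 1 := by
  have h1 := h.card_vert_le_card_edgeSet_add_one
  rw [Nat.card_fin] at h1
  exact h1.trans (Nat.add_le_add_right (card_edgeSet_listGraph_le l) 1)

/-- The factors generate the transitive permutation `c`, so the graph is connected, and it has at
most `n - 1` edges. -/
theorem graph_isTree (hn : 1 ≤ n) (v : F n) : (graph v).IsTree := by
  have hconn : (graph v).Connected := by
    have h0 : ∀ i (hi : i < n), (graph v).Reachable ⟨0, hn⟩ ⟨i, hi⟩ := by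
      intro i
      induction i with
      | zero => intro _; rfl
      | succ i ih =>
        intro hi
        refine (ih (by omega)).trans ?_
        have := listGraph_reachable v.word v.isSwap v.word (fun _ h => h) ⟨i, by omega⟩
        rwa [v.prod_word, longCycle_apply hi] at this
    have : Nonempty (Fin n) := ⟨⟨0, hn⟩⟩
    exact ⟨fun a b => (h0 a.1 a.2).symm.trans (h0 b.1 b.2)⟩
  rw [SimpleGraph.isTree_iff_connected_and_card]
  refine ⟨hconn, ?_⟩
  have h1 := hconn.card_vert_le_card_edgeSet_add_one
  have h2 : Nat.card (graph v).edgeSet ≤ v.word.length := card_edgeSet_listGraph_le v.word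
  rw [v.length_word] at h2
  rw [Nat.card_fin] at h1 ⊢
  omega

/-- Hurwitz moves: a factor can be moved to the front by conjugating the factors it passes. -/
theorem exists_prod_mul_eq {l : List (Perm (Fin n))} (hl : ∀ t ∈ l, t.IsSwap) (σ : Perm (Fin n)) :
    ∃ l' : List (Perm (Fin n)), l'.length = l.length ∧ (∀ t ∈ l', t.IsSwap) ∧
      l.prod * σ = σ * l'.prod := by
  induction l with
  | nil => exact ⟨[], rfl, by simp, by simp⟩
  | cons t l ih =>
    obtain ⟨l', h1, h2, h3⟩ := ih fun t ht => hl t (by simp [ht])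
    obtain ⟨a, b, hab, rfl⟩ := hl t (by simp)
    refine ⟨swap (σ⁻¹ a) (σ⁻¹ b) :: l', by simp [h1], ?_, ?_⟩
    · intro t ht
      rcases List.mem_cons.1 ht with rfl | ht
      · exact ⟨_, _, by simpa using hab, rfl⟩
      · exact h2 t ht
    · rw [List.prod_cons, List.prod_cons, mul_assoc, h3, ← mul_assoc, ← mul_assoc,
        swap_mul_eq_mul_swap]

theorem exists_two_mul_prod {A B D : List (Perm (Fin n))} {t s : Perm (Fin n)}
    (h : ∀ r ∈ A ++ t :: (B ++ s :: D), r.IsSwap) :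
    ∃ l : List (Perm (Fin n)), l.length + 2 = (A ++ t :: (B ++ s :: D)).length ∧
      (∀ r ∈ l, r.IsSwap) ∧ t * s * l.prod = (A ++ t :: (B ++ s :: D)).prod := by
  obtain ⟨A', a1, a2, a3⟩ := exists_prod_mul_eq (l := A) (fun r hr => h r (by simp [hr])) t
  obtain ⟨C, c1, c2, c3⟩ := exists_prod_mul_eq (l := A' ++ B) (fun r hr => by
    rcases List.mem_append.1 hr with hr | hr
    · exact a2 r hr
    · exact h r (by simp [hr])) s
  refine ⟨C ++ D, ?_, fun r hr => ?_, ?_⟩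
  · simp only [List.length_append, List.length_cons] at c1 ⊢; omega
  · rcases List.mem_append.1 hr with hr | hr
    · exact c2 r hr
    · exact h r (by simp [hr])
  · simp only [List.prod_append, List.prod_cons] at c3 ⊢
    rw [← mul_assoc A.prod, a3, mul_assoc t s, ← mul_assoc s, ← c3]
    simp only [mul_assoc]

/-- For a crossing pair, `(b d)(a c)` times the long cycle is again an `n`-cycle: it runs through
the blocks from `a`, from `d` (wrapping around past `n - 1`), from `c` and from `b`, and returns to
`a`. -/
theorem reachable_of_crossing {G : SimpleGraph (Fin n)} {a b c d : Fin n} (hab : a < b)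
    (hbc : b < c) (hcd : c < d)
    (h : ∀ x, G.Reachable x (swap b d (swap a c (longCycle n x)))) (x : Fin n) :
    G.Reachable a x := by
  have hab' : a.1 < b.1 := hab
  have hbc' : b.1 < c.1 := hbc
  have hcd' : c.1 < d.1 := hcd
  have hd := d.2
  have step : ∀ j (hj : j + 1 < n), G.Reachable ⟨j, by omega⟩ (swap b d (swap a c ⟨j + 1, hj⟩)) := by
    intro j hj
    have := h ⟨j, by omega⟩
    rwa [longCycle_apply hj] at this
  have step' : ∀ y : Fin n, (hy : 0 < y.1) →
      G.Reachable ⟨y.1 - 1, by omega⟩ (swap b d (swap a c y)) := by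
    intro y hy
    have := step (y.1 - 1) (by omega)
    rwa [show (⟨y.1 - 1 + 1, by omega⟩ : Fin n) = y from Fin.ext (by simp only; omega)] at this
  have fix : ∀ y : Fin n, y ≠ a → y ≠ b → y ≠ c → y ≠ d → swap b d (swap a c y) = y := by
    intro y h1 h2 h3 h4
    rw [swap_apply_of_ne_of_ne h1 h3, swap_apply_of_ne_of_ne h2 h4]
  have interval : ∀ lo i (hlo : lo ≤ i) (hi : i < n),
      (∀ j, lo < j → j ≤ i → j ≠ a.1 ∧ j ≠ b.1 ∧ j ≠ c.1 ∧ j ≠ d.1) →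
      G.Reachable ⟨lo, by omega⟩ ⟨i, hi⟩ := by
    intro lo i hlo
    induction i, hlo using Nat.le_induction with
    | base => intro _ _; rfl
    | succ i hlo ih =>
      intro hi hj
      refine (ih (by omega) fun j h1 h2 => hj j h1 (by omega)).trans ?_
      obtain ⟨h1, h2, h3, h4⟩ := hj (i + 1) (by omega) le_rfl
      have := step i hi
      rwa [fix _ (Fin.ne_of_val_ne h1) (Fin.ne_of_val_ne h2) (Fin.ne_of_val_ne h3)
        (Fin.ne_of_val_ne h4)] at this
  have sa : swap b d (swap a c a) = c := by
    rw [swap_apply_left, swap_apply_of_ne_of_ne hbc.ne' hcd.ne]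
  have sb : swap b d (swap a c b) = d := by
    rw [swap_apply_of_ne_of_ne hab.ne' hbc.ne, swap_apply_left]
  have sc : swap b d (swap a c c) = a := by
    rw [swap_apply_right, swap_apply_of_ne_of_ne hab.ne (hab.trans (hbc.trans hcd)).ne]
  have sd : swap b d (swap a c d) = b := by
    rw [swap_apply_of_ne_of_ne (hab.trans (hbc.trans hcd)).ne' hcd.ne', swap_apply_right]
  have had : G.Reachable a d := by
    have h1 := interval a.1 (b.1 - 1) (by omega) (by omega) (by omega)
    have h2 := step' b (by omega)
    rw [sb] at h2
    exact h1.trans h2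
  have hba : G.Reachable b a := by
    have h1 := interval b.1 (c.1 - 1) (by omega) (by omega) (by omega)
    have h2 := step' c (by omega)
    rw [sc] at h2
    exact h1.trans h2
  have hcb : G.Reachable c b := by
    have h1 := interval c.1 (d.1 - 1) (by omega) (by omega) (by omega)
    have h2 := step' d (by omega)
    rw [sd] at h2
    exact h1.trans h2
  have hac := (hcb.trans hba).symm
  -- Only this case passes from `n - 1` to `0`; here `a > 0`, so the swaps fix `0`.
  rcases lt_or_ge x.1 a.1 with hx | hx
  · have h1 := interval d.1 (n - 1) (by omega) (by omega) (by omega)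
    have h2 := h ⟨n - 1, by omega⟩
    have h3 : longCycle n ⟨n - 1, by omega⟩ = ⟨0, by omega⟩ := by
      obtain ⟨m, rfl⟩ : ∃ m, n = m + 1 := ⟨n - 1, by omega⟩
      exact finRotate_last'
    rw [h3, fix _ (Fin.ne_of_val_ne (by simp only; omega)) (Fin.ne_of_val_ne (by simp only; omega))
      (Fin.ne_of_val_ne (by simp only; omega)) (Fin.ne_of_val_ne (by simp only; omega))] at h2
    exact had.trans (h1.trans (h2.trans (interval 0 x.1 (by omega) x.2 (by omega))))
  rcases lt_or_ge x.1 b.1 with hx' | hx'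
  · exact interval a.1 x.1 hx x.2 (by omega)
  rcases lt_or_ge x.1 c.1 with hx' | hx'
  · exact hba.symm.trans (interval b.1 x.1 (by omega) x.2 (by omega))
  rcases lt_or_ge x.1 d.1 with hx' | hx'
  · exact hac.trans (interval c.1 x.1 (by omega) x.2 (by omega))
  · exact had.trans (interval d.1 x.1 (by omega) x.2 (by omega))

/-- Moving the crossing factors to the front leaves `n - 3` transpositions whose product is still
transitive, but connecting `n` vertices takes `n - 1`. -/
theorem not_crossing {v : F n} {a b c d : Fin n} (hab : a < b) (hbc : b < c) (hcd : c < d)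
    {A B D : List (Perm (Fin n))} {t s : Perm (Fin n)} (hw : v.word = A ++ t :: (B ++ s :: D))
    (hts : t * s = swap a c * swap b d) : False := by
  obtain ⟨l, h1, h2, h3⟩ := exists_two_mul_prod (hw ▸ v.isSwap)
  rw [← hw, v.length_word] at h1
  rw [← hw, v.prod_word, hts] at h3
  have hl : l.prod = swap b d * (swap a c * longCycle n) := by
    rw [← h3, ← mul_assoc, ← mul_assoc, ← mul_assoc]; simp [mul_assoc]
  have hreach := reachable_of_crossing (G := listGraph l) hab hbc hcd fun x => by
    have := listGraph_reachable l h2 l (fun _ h => h) x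
    rwa [hl] at this
  have : Nonempty (Fin n) := ⟨a⟩
  have := card_le_of_connected_listGraph (l := l) ⟨fun x y => (hreach x).symm.trans (hreach y)⟩
  omega

theorem exists_append_of_mem_of_mem {α : Type*} {l : List α} {x y : α} (hx : x ∈ l) (hy : y ∈ l)
    (hne : x ≠ y) :
    (∃ A B D, l = A ++ x :: (B ++ y :: D)) ∨ ∃ A B D, l = A ++ y :: (B ++ x :: D) := by
  obtain ⟨A, C, rfl⟩ := List.append_of_mem hx
  rw [List.mem_append, List.mem_cons] at hy
  rcases hy with hy | hy | hy
  · obtain ⟨A', B, rfl⟩ := List.append_of_mem hy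
    exact Or.inr ⟨A', B, C, by simp⟩
  · exact absurd hy.symm hne
  · obtain ⟨B, D, rfl⟩ := List.append_of_mem hy
    exact Or.inl ⟨A, B, D, rfl⟩

theorem graph_isNonCrossing (v : F n) : IsNonCrossing (graph v) := by
  rw [isNonCrossing_iff]
  rintro a b c d hab hbc hcd ⟨h1, h2⟩
  have hac := hab.trans hbc
  have hbd := hbc.trans hcd
  have hne : swap a c ≠ swap b d := by
    rw [Ne, swap_eq_swap_iff_of_lt hac hbd]
    exact fun h => hab.ne h.1
  rcases exists_append_of_mem_of_mem h1.2 h2.2 hne with ⟨A, B, D, h⟩ | ⟨A, B, D, h⟩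
  · exact not_crossing hab hbc hcd h rfl
  · refine not_crossing hab hbc hcd h ?_
    rw [mul_swap_eq_swap_mul (swap b d), swap_apply_of_ne_of_ne hab.ne (hac.trans hcd).ne,
      swap_apply_of_ne_of_ne hbc.ne' hcd.ne]

/-- Let `b` be the largest neighbor of the first vertex `z`. An edge leaving `[z, b]` from `z`
contradicts the choice of `b`, from an interior point it crosses `{z, b}`, and from `b` it breaks
alternation. By connectedness, `b` is the last vertex. -/
theorem zero_adj_last {T : SimpleGraph (Fin n)} (hT : T ∈ alternatingNonCrossingTrees n)
    {z w : Fin n} (hz : z.1 = 0) (hw : w.1 = n - 1) (hzw : z ≠ w) : T.Adj z w := by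
  classical
  obtain ⟨htree, hnc, halt⟩ := hT
  rw [isNonCrossing_iff] at hnc
  set N := Finset.univ.filter fun j : Fin n => j = z ∨ T.Adj z j with hN
  obtain ⟨b, hbN, hmax⟩ := N.exists_max_image id ⟨z, by simp [hN]⟩
  have hzle : ∀ j : Fin n, z ≤ j := fun j => by rw [Fin.le_def]; omega
  have hmax' : ∀ j, T.Adj z j → j ≤ b := fun j hj => hmax j (by simp [hN, hj])
  have hb : b = z ∨ T.Adj z b := by simpa [hN] using hbN
  have hclosed : ∀ p q : Fin n, T.Adj p q → p ≤ b → q ≤ b := by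
    intro p q hpq hpb
    by_contra! hq
    by_cases hpz : p = z
    · subst hpz; exact absurd (hmax' q hpq) hq.not_ge
    have hzp : z < p := lt_of_le_of_ne (hzle p) (Ne.symm hpz)
    rcases hb with rfl | hb
    · exact absurd hpb hzp.not_ge
    rcases hpb.eq_or_lt with rfl | hlt
    · rcases halt p with h | h
      · exact absurd (h z hb.symm) hzp.not_gt
      · exact absurd (h q hpq) hq.not_gt
    · exact hnc z p b q hzp hlt hq ⟨hb, hpq⟩
  have hall : ∀ j, T.Reachable z j → j ≤ b := by
    rintro j ⟨p⟩
    have : ∀ (x y : Fin n) (p : T.Walk x y), x ≤ b → y ≤ b := by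
      intro x y p
      induction p with
      | nil => exact id
      | cons h p ih => exact fun hx => ih (hclosed _ _ h hx)
    exact this _ _ p (hzle b)
  have hlast := hall w (htree.1.preconnected _ _)
  have hbw : b = w := by omega
  rw [← hbw] at hzw ⊢
  exact hb.resolve_left hzw.symm

end Graph

/-! ### Chains with decreasing labels and alternating trees -/

section Maximal
variable {n : ℕ}

/-- Let `j < i < k`. If `(j i)` precedes `(i k)`, their labels are at most `i` and greater than `i`,
an increase. The other order never occurs: after `(i k)` the image of `i` stays above `i`, which
forbids the step `(j i)`. -/
theorem graph_isAlternating {v : F n} (h : v.labels.Pairwise (· > ·)) :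
    IsAlternating (graph v) := by
  have key : ∀ j i k : Fin n, j < i → i < k → swap j i ∈ v.word → swap i k ∈ v.word → False := by
    intro j i k hji hik h1 h2
    have hne : swap j i ≠ swap i k := by
      rw [Ne, swap_eq_swap_iff_of_lt hji hik]; exact fun h => hji.ne h.1
    have hst := v.steps
    rcases exists_append_of_mem_of_mem h1 h2 hne with ⟨A, B, D, hw⟩ | ⟨A, B, D, hw⟩
    · rw [F.labels, hw, labels_append, labels, labels_append, labels, List.pairwise_append,
        List.pairwise_cons] at h
      have hlt := h.2.1.1 _ (List.mem_append_right _ List.mem_cons_self)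
      rw [hw] at hst
      have s1 := hst.isStep hji
      rw [← List.cons_append, ← List.append_assoc] at hst
      have s2 := hst.isStep hik
      rw [label_swap _ hji, label_swap _ hik] at hlt
      rw [List.prod_append, List.prod_cons, ← mul_assoc, ← mul_assoc] at s2
      have := s1.apply_le
      have := s2.lt_apply
      omega
    · rw [hw, ← List.cons_append, ← List.append_assoc] at hst
      have s1 := hst.isStep hji
      have := ((steps_append.1 hst).1.persist_swap hik).1
      exact absurd this s1.apply_le.not_gt
  intro i
  by_contra! hcon
  obtain ⟨⟨j, hj, hji⟩, k, hk, hik⟩ := hcon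
  refine key j i k (lt_of_le_of_ne hji hj.ne') (lt_of_le_of_ne hik hk.ne) ?_ hk.2
  rw [swap_comm]; exact hj.2

/-- Transpositions with the same smaller entry appear with decreasing larger entry. -/
theorem Steps.lt_of_append {A B D : List (Perm (Fin n))} {π : Perm (Fin n)} {a b b' : Fin n}
    (hab : a < b) (hab' : a < b') (h : Steps π (A ++ swap a b :: (B ++ swap a b' :: D))) :
    b' < b := by
  rw [← List.cons_append, ← List.append_assoc] at h
  have h1 := (steps_append.1 h).1.persist_swap hab
  exact ((h.isStep hab').lt_of_lt h1.1).trans_le h1.2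

/-- The last letter `(a b)` is determined: the whole product sends `a` to the last label, and `b` is
the smallest larger partner of `a` because those partners appear in decreasing order. Remove it and
repeat. -/
theorem Steps.eq_of_labels_eq {l l' : List (Perm (Fin n))} (h : Steps 1 l) (h' : Steps 1 l')
    (hp : l.prod = l'.prod) (hl : labels 1 l = labels 1 l') (hm : ∀ t, t ∈ l ↔ t ∈ l') :
    l = l' := by
  induction l using List.reverseRecOn generalizing l' with
  | nil =>
    have := congrArg List.length hl
    rw [length_labels, length_labels] at this
    exact (List.eq_nil_of_length_eq_zero this.symm).symm
  | append_singleton m t ih =>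
    have hlen := congrArg List.length hl
    rw [length_labels, length_labels] at hlen
    rcases List.eq_nil_or_concat' l' with rfl | ⟨m', t', rfl⟩
    · simp at hlen
    have hnot : ∀ (m : List (Perm (Fin n))) (a b b' : Fin n), a < b → a < b' →
        Steps 1 (m ++ [swap a b']) → swap a b ∈ m → b' < b := by
      intro m a b b' hab hab' hs hmem
      obtain ⟨A, B, rfl⟩ := List.append_of_mem hmem
      rw [List.append_assoc, List.cons_append] at hs
      exact hs.lt_of_append hab hab'
    obtain ⟨hs, ⟨a, b, rfl, hab⟩, -⟩ := steps_append.1 h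
    obtain ⟨hs', ⟨a', b', rfl, hab'⟩, -⟩ := steps_append.1 h'
    simp only [List.length_append, List.length_singleton] at hlen
    rw [labels_append, labels_append] at hl
    obtain ⟨hl1, hl2⟩ := List.append_inj hl (by rw [length_labels, length_labels]; omega)
    simp only [labels, label_swap _ hab.lt, label_swap _ hab'.lt, one_mul, List.cons.injEq,
      and_true] at hl2
    have ha : a = a' := by
      apply (m ++ [swap a b]).prod.injective
      conv_rhs => rw [hp]
      simpa [Fin.ext_iff] using hl2
    subst ha
    have hb : b = b' := by
      rcases lt_trichotomy b b' with hlt | heq | hlt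
      · have h1 := (hm (swap a b)).1 (by simp)
        rw [List.mem_append, List.mem_singleton, swap_eq_swap_iff_of_lt hab.lt hab'.lt] at h1
        exact absurd (hnot m' a b b' hab.lt hab'.lt h' (h1.resolve_right fun h => hlt.ne h.2))
          hlt.not_gt
      · exact heq
      · have h1 := (hm (swap a b')).2 (by simp)
        rw [List.mem_append, List.mem_singleton, swap_eq_swap_iff_of_lt hab'.lt hab.lt] at h1
        exact absurd (hnot m a b' b hab'.lt hab.lt h (h1.resolve_right fun h => hlt.ne h.2))
          hlt.not_gt
    subst hb
    have hn1 : swap a b ∉ m := fun hmem => lt_irrefl _ (hnot m a b b hab.lt hab.lt h hmem)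
    have hn2 : swap a b ∉ m' := fun hmem => lt_irrefl _ (hnot m' a b b hab.lt hab.lt h' hmem)
    rw [ih hs hs' ?_ hl1 fun t => ?_]
    · simpa using hp
    · have := hm t
      simp only [List.mem_append, List.mem_singleton] at this
      by_cases ht : t = swap a b
      · subst ht; exact ⟨fun h => absurd h hn1, fun h => absurd h hn2⟩
      · simpa [ht] using this

theorem eq_of_graph_eq {u v : F n} (hu : u.labels.Pairwise (· > ·))
    (hv : v.labels.Pairwise (· > ·)) (h : graph u = graph v) : u = v := by
  have hsub : ∀ {u v : F n}, graph u = graph v → ∀ t ∈ u.word, t ∈ v.word := by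
    intro u v h t ht
    obtain ⟨a, b, hab, rfl⟩ := u.isSwap t ht
    have : (graph u).Adj a b := ⟨hab, ht⟩
    rw [h] at this
    exact this.2
  ext1
  refine u.steps.eq_of_labels_eq v.steps (by rw [u.prod_word, v.prod_word]) ?_
    fun t => ⟨hsub h t, hsub h.symm t⟩
  exact (F.labels_of_pairwise_gt hu).trans (F.labels_of_pairwise_gt hv).symm

theorem prod_apply_mem_iff {α : Type*} {l : List (Perm α)} {K : Set α}
    (h : ∀ t ∈ l, ∀ i, t i ∈ K ↔ i ∈ K) (i : α) : l.prod i ∈ K ↔ i ∈ K := by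
  induction l with
  | nil => simp
  | cons t l ih =>
    rw [List.prod_cons, Perm.mul_apply, h t (by simp), ih fun t ht => h t (by simp [ht])]

theorem swap_apply_mem_iff {α : Type*} [DecidableEq α] {K : Set α} {c d : α} (h : c ∈ K ↔ d ∈ K)
    (i : α) : swap c d i ∈ K ↔ i ∈ K := by
  by_cases hc : i = c
  · subst hc; rw [swap_apply_left]; exact h.symm
  · by_cases hd : i = d
    · subst hd; rw [swap_apply_right]; exact h
    · rw [swap_apply_of_ne_of_ne hc hd]

theorem steps_map_swap {l : List (Fin n × Fin n)} {π : Perm (Fin n)}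
    (h : ∀ A p B, l = A ++ p :: B →
      IsStep (π * (A.map fun p => swap p.1 p.2).prod) p.1 p.2) :
    Steps π (l.map fun p => swap p.1 p.2) := by
  induction l generalizing π with
  | nil => trivial
  | cons q l ih =>
    refine ⟨⟨q.1, q.2, rfl, by simpa using h [] q l rfl⟩, ih fun A p B he => ?_⟩
    have := h (q :: A) p B (by rw [he]; rfl)
    rwa [List.map_cons, List.prod_cons, ← mul_assoc] at this

/-- Every alternating non-crossing tree is the graph of a factorization: list the edges by
decreasing smaller end, then by decreasing larger end. -/
theorem exists_graph_eq {T : SimpleGraph (Fin n)} (hT : T ∈ alternatingNonCrossingTrees n) :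
    ∃ v : F n, graph v = T := by
  classical
  obtain ⟨htree, hnc, halt⟩ := hT
  rw [isNonCrossing_iff] at hnc
  let P : Finset (Fin n ×ₗ Fin n) :=
    Finset.univ.filter fun p => (ofLex p).1 < (ofLex p).2 ∧ T.Adj (ofLex p).1 (ofLex p).2
  let l : List (Fin n × Fin n) := (P.sort (· ≥ ·)).map ofLex
  have hmem : ∀ p : Fin n × Fin n, p ∈ l ↔ p.1 < p.2 ∧ T.Adj p.1 p.2 := by
    intro p
    simp only [l, List.mem_map, Finset.mem_sort]
    constructor
    · rintro ⟨q, hq, rfl⟩; simpa [P] using hq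
    · intro h; exact ⟨toLex p, by simpa [P] using h, rfl⟩
  have hpair : l.Pairwise fun p q => q.1 < p.1 ∨ q.1 = p.1 ∧ q.2 < p.2 := by
    rw [List.pairwise_map]
    refine (P.sortedGT_sort).pairwise.imp ?_
    intro p q h
    simpa [Prod.Lex.lt_iff] using h
  have hsteps : Steps 1 (l.map fun p => swap p.1 p.2) := by
    refine steps_map_swap ?_
    rintro A ⟨a, b⟩ B he
    rw [one_mul]
    have hab := (hmem (a, b)).1 (by rw [he]; simp)
    simp only at hab ⊢
    rw [he, List.pairwise_append] at hpair
    -- Every edge listed before `(a, b)` has both ends in `(a, b]` or neither, by the order of the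
    -- list, alternation at `b` and non-crossing. So the prefix preserves `(a, b]`, and this gives
    -- the step conditions.
    have hK := prod_apply_mem_iff (l := A.map fun p => swap p.1 p.2) (K := {i | a < i ∧ i ≤ b})
      (by
        intro t ht
        obtain ⟨⟨c, d⟩, hcd, rfl⟩ := List.mem_map.1 ht
        have h1 := (hmem (c, d)).1 (by rw [he]; simp [hcd])
        have h2 := hpair.2.2 _ hcd _ List.mem_cons_self
        simp only at h1 h2 ⊢
        refine swap_apply_mem_iff ?_
        simp only [Set.mem_ofPred_eq]
        have hcb : c ≠ b := by
          rintro rfl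
          rcases halt c with h | h
          · exact absurd (h a hab.2.symm) hab.1.not_gt
          · exact absurd (h d h1.2) h1.1.not_gt
        have hcr : ¬(a < c ∧ c < b ∧ b < d) := fun ⟨g1, g2, g3⟩ =>
          hnc a c b d g1 g2 g3 ⟨hab.2, h1.2⟩
        omega)
    have hb := (hK b).2 ⟨hab.1, le_rfl⟩
    have ha := mt (hK a).1 fun h => lt_irrefl _ h.1
    exact ⟨hab.1, hb.1, hb.2, fun h => not_le.1 fun h' => ha ⟨h, h'⟩⟩
  have hadj : ∀ a b, (a ≠ b ∧ swap a b ∈ l.map fun p => swap p.1 p.2) ↔ T.Adj a b := by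
    intro a b
    constructor
    · rintro ⟨hne, hm⟩
      obtain ⟨⟨c, d⟩, hcd, he⟩ := List.mem_map.1 hm
      have h1 := ((hmem (c, d)).1 hcd).2
      have h2 := swap_inj hne he.symm
      rw [← SimpleGraph.mem_edgeSet] at h1 ⊢
      rwa [h2]
    · intro h
      refine ⟨h.ne, ?_⟩
      rcases lt_or_gt_of_ne h.ne with hlt | hlt
      · exact List.mem_map.2 ⟨(a, b), (hmem _).2 ⟨hlt, h⟩, rfl⟩
      · exact List.mem_map.2 ⟨(b, a), (hmem _).2 ⟨hlt, h.symm⟩, swap_comm _ _⟩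
  -- The excedances bound the length from above, connectedness of `T` from below.
  have hlen : (l.map fun p => swap p.1 p.2).length = n - 1 := by
    have h1 := hsteps.card_excValues
    have h2 := Finset.card_le_card (excValues_subset (1 * (l.map fun p => swap p.1 p.2).prod))
    rw [card_filter_pos] at h2
    have h3 : listGraph (l.map fun p => swap p.1 p.2) = T := by
      ext a b; exact hadj a b
    have h4 := card_le_of_connected_listGraph (h3 ▸ htree.1)
    rw [excValues_one, Finset.card_empty] at h1
    omega
  refine ⟨ofSteps _ hlen hsteps, ?_⟩
  ext a b
  exact hadj a b

/-- Alternation excludes the pair `(a b)`, `(b d)` at an ascent, so exchanging its labels only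
permutes letters. The process stops because inversions increase and are bounded. -/
theorem exists_pairwise_gt_of_isAlternating {v : F n} (h : IsAlternating (graph v)) :
    ∃ u : F n, graph u = graph v ∧ u.labels.Pairwise (· > ·) := by
  have hle : ∀ u : F n, inversions u.labels ≤ inversions (List.range' 1 (n - 1)).reverse :=
    fun u => inversions_le_of_pairwise_gt (by simp [u.length_labels])
      (List.pairwise_reverse.2 List.pairwise_lt_range')
  induction hk : inversions (List.range' 1 (n - 1)).reverse - inversions v.labels
    using Nat.strong_induction_on generalizing v with
  | _ k ih =>
    by_cases hp : v.labels.Pairwise (· > ·)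
    · exact ⟨v, rfl, hp⟩
    obtain ⟨A, x, y, B, he, hxy⟩ := exists_consecutive_not hp
    have hxy : x < y := by have := F.ne_of_labels_eq he; omega
    obtain ⟨u, -, hul, hor⟩ := exists_adj_exchange v he
    rcases hor hxy with ⟨a, b, d, hab, hbd, h1, h2⟩ | hperm
    · exfalso
      rcases h b with h | h
      · exact absurd (h a ⟨hab.ne', by rwa [swap_comm]⟩) hab.not_gt
      · exact absurd (h d ⟨hbd.ne, h2⟩) hbd.not_gt
    · have hg : graph u = graph v := by
        ext a b
        exact and_congr_right fun _ => hperm.mem_iff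
      have hinv : inversions u.labels = inversions v.labels + 1 := by
        rw [hul, he, inversions_append_swap hxy]
      have := hle u
      obtain ⟨w, hw1, hw2⟩ := ih _ (by omega) (hg ▸ h) rfl
      exact ⟨w, hw1.trans hg, hw2⟩

end Maximal
end HurwitzWeak

theorem theoremt (n : ℕ) (hn : 1 ≤ n) :
    Set.BijOn (fun v : HurwitzWeak.F n => HurwitzWeak.graph v)
      {v : HurwitzWeak.F n | HurwitzWeak.IsWeakMax v}
      (HurwitzWeak.alternatingNonCrossingTrees n) ∧
    ∀ h2 : 2 ≤ n, ∀ v : HurwitzWeak.F n, HurwitzWeak.IsWeakMax v →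
      Equiv.swap (⟨0, by omega⟩ : Fin n) ⟨n - 1, by omega⟩ ∈ v.word := by
  have hmaps : ∀ v : HurwitzWeak.F n, HurwitzWeak.IsWeakMax v →
      HurwitzWeak.graph v ∈ HurwitzWeak.alternatingNonCrossingTrees n := fun v hv =>
    ⟨HurwitzWeak.graph_isTree hn v, HurwitzWeak.graph_isNonCrossing v,
      HurwitzWeak.graph_isAlternating (HurwitzWeak.isWeakMax_iff.1 hv)⟩
  refine ⟨⟨hmaps, fun u hu v hv h => HurwitzWeak.eq_of_graph_eq (HurwitzWeak.isWeakMax_iff.1 hu)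
    (HurwitzWeak.isWeakMax_iff.1 hv) h, fun T hT => ?_⟩,
    fun h2 v hv => (HurwitzWeak.zero_adj_last (hmaps v hv) rfl rfl
      (Fin.ne_of_val_ne (by simp only; omega))).2⟩
  obtain ⟨v, rfl⟩ := HurwitzWeak.exists_graph_eq hT
  obtain ⟨u, hu, hp⟩ := HurwitzWeak.exists_pairwise_gt_of_isAlternating hT.2.2
  exact ⟨u, HurwitzWeak.isWeakMax_iff.2 hp, hu⟩
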